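/- Let $N\ge 0$, let $\mathcal U=\mathbb Z\langle u_1,\dots,u_N\rangle$ be the free associative ring, and let $I_C\subset\mathcal U$ be the two-sided ideal generated by $$u_b^2u_a+u_au_bu_a-u_bu_au_b-u_bu_a^2\quad(a<b),$$ $$u_bu_cu_a+u_au_cu_b-u_bu_au_c-u_cu_au_b\quad(a<b<c),$$ $$u_cu_bu_cu_a+u_bu_cu_au_c-u_cu_bu_au_c-u_bu_c^2u_a\quad(a<b<c).$$ Set $$e_k(\mathbf u)=\sum_{i_1>\cdots>i_k}u_{i_1}\cdots u_{i_k},\qquad h_\ell(\mathbf u)=\sum_{i_1\le\cdots\le i_\ell}u_{i_1}\cdots u_{i_\ell},$$ with $e_0(\mathbf u)=h_0(\mathbf u)=1$ and $e_k(\mathbf u)=0$ for $k<0$, and let $H(x)=\sum_{\ell\ge 0}x^\ell h_\ell(\mathbf u)\in\mathcal U[[x]]$. For a partition $\lambda$ with conjugate $\lambda'$ and $t=\lambda_1$, let $$\mathfrak J_\lambda(\mathbf u)=\sum_{\pi\in S_t}\operatorname{sgn}(\pi)\,e_{\lambda'_1+\pi(1)-1}(\mathbf u)\,e_{\lambda'_2+\pi(2)-2}(\mathbf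 u)\cdots e_{\lambda'_t+\pi(t)-t}(\mathbf u).$$ Let $\mathcal U^*$ be the free $\mathbb Z$-module on the words in the alphabet $\{1,\dots,N\}$, let $\langle\cdot,\cdot\rangle$ be the pairing of $\mathcal U$ with $\mathcal U^*$ for which noncommutative monomials and words are dual bases, extended coefficientwise to $\mathcal U[[x_1,x_2,\dots]]$, and let $I_C^\perp=\{\gamma\in\mathcal U^*:\langle z,\gamma\rangle=0\text{ for all }z\in I_C\}$. For $\gamma\in\mathcal U^*$ define $$F_\gamma(\mathbf x)=\big\langle H(x_1)H(x_2)H(x_3)\cdots,\gamma\big\rangle\in\mathbb Z[[x_1,x_2,\dots]],$$ where the $x_j$ commute with each other and with the $u_i$. Then: 1. For every two-sided ideal $I\supseteq I_C$ of $\mathcal U$, the elements $h_1(\mathbf u),h_2(\mathbf u),\dots$ commute pairwise modulo $I$, and $H(x)H(y)\equiv H(y)H(x)\bmod I[[x,y]]$, where $x,y$ are variables commuting with each other and with the $u_i$. 2. For every $\gamma=\sum_{\mathsf w}\gamma_{\mathsf w}\mathsf w\in\mathcal U^*$, we have $F_\gamma(\mathbf x)=\sum_{\mathsf w}\gamma_{\mathsf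 w}\,Q_{\mathrm{Des}(\mathsf w)}(\mathbf x)$. Here, for a word $\mathsf w=\mathsf w_1\cdots\mathsf w_n$, $\mathrm{Des}(\mathsf w)=\{i\in\{1,\dots,n-1\}:\mathsf w_i>\mathsf w_{i+1}\}$ and $$Q_{\mathrm{Des}(\mathsf w)}(\mathbf x)=\sum_{\substack{1\le i_1\le\cdots\le i_n\\ j\in\mathrm{Des}(\mathsf w)\Rightarrow i_j<i_{j+1}}}x_{i_1}\cdots x_{i_n}.$$ 3. For every $\gamma\in I_C^\perp$, the series $F_\gamma(\mathbf x)$ is symmetric in $x_1,x_2,\dots$; moreover $\langle\mathfrak J_\lambda(\mathbf u),\gamma\rangle\ne0$ for only finitely many partitions $\lambda$, and $$F_\gamma(\mathbf x)=\sum_\lambda s_\lambda(\mathbf x)\,\langle\mathfrak J_\lambda(\mathbf u),\gamma\rangle,$$ where $s_\lambda(\mathbf x)$ is the Schur function, the generating function by content of the semistandard Young tableaux of shape $\lambda$. -/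

import Mathlib

namespace NCSchur

/-- The free associative ring `ℤ⟨u_1, …, u_N⟩`; the alphabet is `Fin N`, that is, the letter
`i + 1` is represented by `i : Fin N`. -/
abbrev U (N : ℕ) : Type := FreeAlgebra ℤ (Fin N)

/-- The generators `u_i`. -/
abbrev u {N : ℕ} (i : Fin N) : U N := FreeAlgebra.ι ℤ i

/-- The free `ℤ`-module spanned by the words in the alphabet. -/
abbrev UDual (N : ℕ) : Type := FreeMonoid (Fin N) →₀ ℤ

/-- The coefficient of the noncommutative monomial `u_w` in `z`. -/
noncomputable def coeffWord {N : ℕ} (w : FreeMonoid (Fin N)) (z : U N) : ℤ :=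
  (FreeAlgebra.equivMonoidAlgebraFreeMonoid z).coeff w

/-- The bilinear pairing between `ℤ⟨u_1, …, u_N⟩` and the module of words for which the basis of
noncommutative monomials is dual to the basis of words. -/
noncomputable def pairing {N : ℕ} (z : U N) (γ : UDual N) : ℤ :=
  γ.sum fun w c => c * coeffWord w z

/-- The orthogonal complement of a two-sided ideal. -/
def perp {N : ℕ} (I : TwoSidedIdeal (U N)) : Set (UDual N) :=
  {γ | ∀ z ∈ I, pairing z γ = 0}

/-- The three families of generators of the ideal `I_C`. -/
def relations (N : ℕ) : Set (U N) :=
  {z | ∃ a b : Fin N, a < b ∧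
    z = u b * u b * u a + u a * u b * u a - u b * u a * u b - u b * u a * u a} ∪
  {z | ∃ a b c : Fin N, a < b ∧ b < c ∧
    z = u b * u c * u a + u a * u c * u b - u b * u a * u c - u c * u a * u b} ∪
  {z | ∃ a b c : Fin N, a < b ∧ b < c ∧
    z = u c * u b * u c * u a + u b * u c * u a * u c
      - u c * u b * u a * u c - u b * u c * u c * u a}

/-- The two-sided ideal `I_C`. -/
def idealC (N : ℕ) : TwoSidedIdeal (U N) := TwoSidedIdeal.span (relations N)

open Classical in
/-- `e_k(u)`, the sum of `u_{i_1} ⋯ u_{i_k}` over `i_1 > ⋯ > i_k`, for `k : ℕ`. -/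
noncomputable def elemNat (N k : ℕ) : U N :=
  ∑ i : Fin k → Fin N with StrictAnti i, (List.ofFn fun j => u (i j)).prod

/-- The noncommutative elementary symmetric function `e_k(u)` for `k : ℤ`, zero for `k < 0`. -/
noncomputable def elem (N : ℕ) (k : ℤ) : U N :=
  if k < 0 then 0 else elemNat N k.toNat

open Classical in
/-- The noncommutative complete homogeneous symmetric function `h_l(u)`, the sum of
`u_{i_1} ⋯ u_{i_l}` over `i_1 ≤ ⋯ ≤ i_l`. -/
noncomputable def homog (N l : ℕ) : U N :=
  ∑ i : Fin l → Fin N with Monotone i, (List.ofFn fun j => u (i j)).prod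

/-- The power series `H(x_j) = ∑_l x_j^l h_l(u)`, in commuting variables indexed by `σ` which also
commute with the `u_i`. A monomial `d` is a power of `x_j` iff its support lies in `{j}`. -/
noncomputable def seriesH (N : ℕ) {σ : Type} [DecidableEq σ] (j : σ) : MvPowerSeries σ (U N) :=
  fun d => if d.support ⊆ {j} then homog N (d j) else 0

/-- The finite product `H(x_0) H(x_1) ⋯ H(x_{n-1})`, multiplied from left to right. -/
noncomputable def partialCauchy (N n : ℕ) : MvPowerSeries ℕ (U N) :=
  ((List.range n).map fun j => seriesH N j).prod

/-- The noncommutative Cauchy product, the infinite product `H(x_0) H(x_1) H(x_2) ⋯`: the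
coefficient of `x^d` is that in any partial product which contains all the variables of `x^d`
(see `coeff_partialCauchy`). -/
noncomputable def cauchyProduct (N : ℕ) : MvPowerSeries ℕ (U N) :=
  fun d => MvPowerSeries.coeff d (partialCauchy N (d.support.sup id + 1))

theorem coeff_partialCauchy_succ (N n : ℕ) (d : ℕ →₀ ℕ) (h : d n = 0) :
    MvPowerSeries.coeff d (partialCauchy N (n + 1)) = MvPowerSeries.coeff d (partialCauchy N n) := by
  classical
  have hs : partialCauchy N (n + 1) = partialCauchy N n * seriesH N n := by
    simp [partialCauchy, List.range_succ]
  rw [hs, MvPowerSeries.coeff_mul, Finset.sum_eq_single (d, 0)]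
  · have : MvPowerSeries.coeff (0 : ℕ →₀ ℕ) (seriesH N n) = 1 := by
      change (if (0 : ℕ →₀ ℕ).support ⊆ {n} then homog N 0 else 0) = 1
      simp [homog, Subsingleton.monotone]
    rw [this, mul_one]
  · rintro ⟨p, q⟩ hpq hne
    rw [Finset.HasAntidiagonal.mem_antidiagonal] at hpq
    simp only at hpq
    have hq : MvPowerSeries.coeff q (seriesH N n) = 0 := by
      have : ¬ q.support ⊆ {n} := by
        intro hsub
        apply hne
        have hq0 : q = 0 := by
          ext m
          by_cases hm : m = n
          · subst hm
            have := DFunLike.congr_fun hpq m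
            simp only [Finsupp.add_apply, h] at this
            simpa using (by omega : q m = 0)
          · by_contra hc
            exact hm (by simpa using hsub (Finsupp.mem_support_iff.2 hc))
        subst hq0
        simpa using hpq
      change (if q.support ⊆ {n} then _ else _) = _
      rw [if_neg this]
    simp [hq]
  · intro hn
    exact absurd (by simp) hn

/-- The coefficients of the partial products stabilize at those of the Cauchy product. -/
theorem coeff_partialCauchy (N n : ℕ) (d : ℕ →₀ ℕ) (h : ∀ j, n ≤ j → d j = 0) :
    MvPowerSeries.coeff d (partialCauchy N n) = MvPowerSeries.coeff d (cauchyProduct N) := by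
  have key : ∀ m k, (∀ j, m ≤ j → d j = 0) →
      MvPowerSeries.coeff d (partialCauchy N (m + k)) =
        MvPowerSeries.coeff d (partialCauchy N m) := by
    intro m k hm
    induction k with
    | zero => rfl
    | succ k ih =>
      rw [← Nat.add_assoc, coeff_partialCauchy_succ N (m + k) d (hm _ (by omega)), ih]
  have h' : ∀ j, d.support.sup id + 1 ≤ j → d j = 0 := by
    intro j hj
    by_contra hc
    have := Finset.le_sup (f := id) (Finsupp.mem_support_iff.2 hc)
    simp only [id] at this
    omega
  change _ = MvPowerSeries.coeff d (partialCauchy N (d.support.sup id + 1))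
  rw [← key n (d.support.sup id + 1) h, ← key (d.support.sup id + 1) n h', Nat.add_comm]

/-- The formal power series `F_γ(x) = ⟨Ω(x, u), γ⟩`; the pairing is applied to the coefficient of
each monomial in the variables `x_0, x_1, …`. -/
noncomputable def F {N : ℕ} (γ : UDual N) : MvPowerSeries ℕ ℤ :=
  fun d => pairing (MvPowerSeries.coeff d (cauchyProduct N)) γ

/-- The descent set of a word, with positions counted from `0`. -/
def descents {N : ℕ} (w : List (Fin N)) : Set ℕ :=
  {j | ∃ h : j + 1 < w.length, w[j + 1] < w[j]}

/-- Gessel's fundamental quasisymmetric function: the sum of `x_{i_0} ⋯ x_{i_{n-1}}` over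
`i_0 ≤ ⋯ ≤ i_{n-1}` such that `i_j < i_{j+1}` for all `j ∈ D`. The coefficient of `x^d` is the
(finite) number of such sequences whose monomial is `x^d`. -/
noncomputable def fundamentalQ (n : ℕ) (D : Set ℕ) : MvPowerSeries ℕ ℤ :=
  fun d => (Nat.card {i : Fin n → ℕ // Monotone i ∧
    (∀ j, ∀ h : j + 1 < n, j ∈ D → i ⟨j, by omega⟩ < i ⟨j + 1, h⟩) ∧
    ∑ j, Finsupp.single (i j) 1 = d} : ℤ)

/-- The Schur function `s_μ(x_0, x_1, …)`, the generating function of the semistandard Young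
tableaux of shape `μ` by content. The coefficient of `x^d` is the (finite) number of tableaux of
content `d`. -/
noncomputable def schur (μ : YoungDiagram) : MvPowerSeries ℕ ℤ :=
  fun d => (Nat.card {T : SemistandardYoungTableau μ //
    ∑ c ∈ μ.cells, Finsupp.single (T c.1 c.2) 1 = d} : ℤ)

/-- The noncommutative Schur function: the sum over the permutations `π` of the `t = μ_1` indices
of `sgn(π) e_{μ'_1 + π(1) - 1}(u) ⋯ e_{μ'_t + π(t) - t}(u)`, where `μ'` is the conjugate
partition (the list of column lengths). -/
noncomputable def ncSchur (N : ℕ) (μ : YoungDiagram) : U N :=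
  ∑ π : Equiv.Perm (Fin (μ.rowLen 0)), (Equiv.Perm.sign π : ℤ) •
    (List.ofFn fun i : Fin (μ.rowLen 0) =>
      elem N ((μ.colLen i : ℤ) + ((π i : ℕ) : ℤ) - ((i : ℕ) : ℤ))).prod

/-- A power series in `x_0, x_1, …` is symmetric if it is invariant under all permutations of the
variables. -/
def IsSymmetricSeries (f : MvPowerSeries ℕ ℤ) : Prop :=
  ∀ σ : Equiv.Perm ℕ, MvPowerSeries.rename σ f = f

end NCSchur

/-! Let E(x) = ∑ x^k e_k(u), the product of the factors 1 + x u_i with i decreasing. Writing [p, q]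
= pq - qp, the relations of I_C for a < b < c say that c[c,a] = [c,a]a, that b commutes with [a,c],
and that [c,b][c,a] = 0. Adding the largest letter c to a list M of smaller ones, these give (1 +
xc)[E_M(x), c] = x (∑_{a ∈ M} [a,c]) E_M(x) (`commutator_linearProd`), and induction on the alphabet
yields E(x)E(y) = E(y)E(x) (`linearProd_comm`). Since E(-x)H(x) = 1 already holds in the free ring,
each h_k is a polynomial in the e_j. So modulo I_C all e_k and h_k lie in one commutative ring
(`exists_commRing_lift`), which settles the commutation claims.

The quasisymmetric expansion uses no relations: the coefficient of x^d in the Cauchy product is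
h_{d_0} h_{d_1} ⋯, and a word occurs in it, with coefficient 1, exactly when the sorted index
sequence of content d is strict at the descents of the word.

For the Schur expansion only commutative algebra remains. Symmetry holds because ∏ h_{d_j} ignores
the order of the variables. Jacobi–Trudi determinants in the e_k satisfy the Pieri rule
(`columnDet_mul_eq_sum`), obtained from one determinant with entries linear in X. Kostka numbers
satisfy the matching branching rule (`kostka_eq_sum`), so ∏ h_{d_j} is the sum of the determinants
weighted by Kostka numbers. Pairing with γ ∈ I_C^⊥ factors through the quotient and gives the
coefficients of the Schur functions. -/

namespace NCSchur

/-! ### Commutation of the generating functions E(x) and E(y) -/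

section Commutation

variable {K R : Type*} [CommRing K] [Ring R] [Algebra K R]

/-- The product of the factors `1 + x a` over a list, from left to right. -/
def linearProd (x : K) (L : List R) : R := (L.map fun a => 1 + x • a).prod

@[simp] lemma linearProd_nil (x : K) : linearProd x ([] : List R) = 1 := rfl

@[simp] lemma linearProd_cons (x : K) (a : R) (L : List R) :
    linearProd x (a :: L) = (1 + x • a) * linearProd x L := rfl

/-- The relations of `I_C` for a list of ring elements in decreasing order. -/
def SatisfiesRelations : List R → Prop
  | [] => True
  | c :: M => (∀ a ∈ M, c * (c * a - a * c) = (c * a - a * c) * a) ∧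
      M.Pairwise (fun b a => b * (a * c - c * a) = (a * c - c * a) * b ∧
        (c * b - b * c) * (c * a - a * c) = 0) ∧ SatisfiesRelations M

/-- By the Leibniz rule the commutator is a sum of terms prefix · x[a,c] · suffix. Letters of the
prefix commute with [a,c], so [a,c] can be moved left until it meets z. In the induction the prefix
is absorbed into z. -/
lemma mul_commutator_linearProd_eq_zero (x : K) (c : R) (M : List R)
    (hM : M.Pairwise fun b a => b * (a * c - c * a) = (a * c - c * a) * b) (z : R)
    (hz : ∀ a ∈ M, z * (a * c - c * a) = 0) :
    z * (linearProd x M * c - c * linearProd x M) = 0 := by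
  induction M generalizing z with
  | nil => simp
  | cons a M ih =>
    rw [List.pairwise_cons] at hM
    have h1 := ih hM.2 (z * (1 + x • a)) (by
      intro b hb
      have h2 := hM.1 b hb
      have h3 := hz b (by simp [hb])
      have : z * (1 + x • a) * (b * c - c * b)
          = z * (b * c - c * b) + x • (z * (a * (b * c - c * b))) := by
        simp only [mul_add, add_mul, mul_one, mul_smul_comm, smul_mul_assoc, mul_assoc]
      rw [this, h2, ← mul_assoc, h3]
      simp)
    have h2 := hz a (by simp)
    have : z * (linearProd x (a :: M) * c - c * linearProd x (a :: M))
        = x • (z * (a * c - c * a) * linearProd x M)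
          + z * (1 + x • a) * (linearProd x M * c - c * linearProd x M) := by
      simp only [linearProd_cons, mul_add, add_mul, mul_sub, sub_mul, mul_one, one_mul,
        mul_smul_comm, smul_mul_assoc, mul_assoc]
      module
    rw [this, h1, h2]
    simp

/-- Although [E_M(x), c] has no simple form, the factor 1 + xc makes it one. To add a letter b, swap
1 + xc with 1 + xb: the error x²[c,b][E_M(x), c] vanishes by the previous lemma, and c[b,c] = [b,c]b
restores the factor 1 + xb. -/
lemma commutator_linearProd (x : K) (c : R) (M : List R) (h : SatisfiesRelations (c :: M)) :
    (1 + x • c) * (linearProd x M * c - c * linearProd x M)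
      = x • ((M.map fun a => a * c - c * a).sum * linearProd x M) := by
  obtain ⟨h1, h2, -⟩ := h
  induction M with
  | nil => simp
  | cons b M ih =>
    rw [List.pairwise_cons] at h2
    have ih' := ih (fun a ha => h1 a (by simp [ha])) h2.2
    have hb := h1 b (by simp)
    have hzero : (c * b - b * c) * (linearProd x M * c - c * linearProd x M) = 0 := by
      refine mul_commutator_linearProd_eq_zero x c M (h2.2.imp fun h => h.1) _ fun a ha => ?_
      have := (h2.1 a ha).2
      rw [← neg_sub (c * a) (a * c), mul_neg, this, neg_zero]
    have hcomm : b * (M.map fun a => a * c - c * a).sum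
        = (M.map fun a => a * c - c * a).sum * b := by
      rw [← List.sum_map_mul_left, ← List.sum_map_mul_right]
      exact congrArg List.sum (List.map_congr_left fun a ha => (h2.1 a ha).1)
    have key : (1 + x • c) * (linearProd x (b :: M) * c - c * linearProd x (b :: M))
        = x • ((b * c - c * b) * linearProd x M)
          - (x * x) • (c * (c * b - b * c) * linearProd x M)
          + (1 + x • b) * ((1 + x • c) * (linearProd x M * c - c * linearProd x M))
          + (x * x) • ((c * b - b * c) * (linearProd x M * c - c * linearProd x M)) := by
      simp only [linearProd_cons, mul_add, add_mul, mul_sub, sub_mul, one_mul,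
        mul_smul_comm, smul_mul_assoc, mul_assoc]
      module
    rw [key, ih', hb, hzero]
    have : (1 + x • b) * (x • ((M.map fun a => a * c - c * a).sum * linearProd x M))
        = x • ((M.map fun a => a * c - c * a).sum * linearProd x M)
          + (x * x) • (b * (M.map fun a => a * c - c * a).sum * linearProd x M) := by
      simp only [add_mul, one_mul, mul_smul_comm, smul_mul_assoc, mul_assoc]
      module
    rw [this, hcomm]
    simp only [linearProd_cons, List.map_cons, List.sum_cons, mul_add, add_mul, sub_mul,
      one_mul, mul_smul_comm, smul_mul_assoc, mul_assoc]
    module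

/-- Moving the second factor 1 + tc to the left past E_M(s) costs t(1 + sc)[E_M(s), c]E_M(t), which
is st(∑[a,c])E_M(s)E_M(t). Both this and the main term are symmetric in s and t by induction. -/
theorem linearProd_comm (x y : K) (L : List R) (h : SatisfiesRelations L) :
    linearProd x L * linearProd y L = linearProd y L * linearProd x L := by
  induction L with
  | nil => simp
  | cons c M ih =>
    have hx := commutator_linearProd x c M h
    have hy := commutator_linearProd y c M h
    have ih' := ih h.2.2
    have key : ∀ s t : K, linearProd s (c :: M) * linearProd t (c :: M)
        = (1 + (s + t) • c + (s * t) • (c * c)) * (linearProd s M * linearProd t M)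
          + t • ((1 + s • c) * (linearProd s M * c - c * linearProd s M) * linearProd t M) := by
      intro s t
      simp only [linearProd_cons, mul_add, add_mul, mul_sub, sub_mul, one_mul,
        mul_smul_comm, smul_mul_assoc, mul_assoc]
      module
    rw [key x y, key y x, hx, hy, smul_mul_assoc, smul_mul_assoc, mul_assoc, mul_assoc, ih',
      smul_smul, smul_smul, mul_comm x y, add_comm x y]

end Commutation

/-! ### Commutation of the coefficients e_k -/

section ListEsymm

open Polynomial

variable {A B : Type*} [Ring A] [Ring B]

/-- The noncommutative elementary symmetric function of a list of ring elements. -/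
def listEsymm (L : List A) (k : ℕ) : A := ((L.sublistsLen k).map List.prod).sum

@[simp] lemma listEsymm_zero (L : List A) : listEsymm L 0 = 1 := by simp [listEsymm]

@[simp] lemma listEsymm_nil_succ (k : ℕ) : listEsymm ([] : List A) (k + 1) = 0 := by
  simp [listEsymm]

lemma listEsymm_cons_succ (a : A) (L : List A) (k : ℕ) :
    listEsymm (a :: L) (k + 1) = listEsymm L (k + 1) + a * listEsymm L k := by
  simp only [listEsymm, List.sublistsLen_succ_cons, List.map_append, List.sum_append, List.map_map]
  congr 1
  rw [← List.sum_map_mul_left]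
  simp [Function.comp_def]

lemma coeff_prod_one_add_X_mul_C (L : List A) (k : ℕ) :
    ((L.map fun a => (1 + X * C a : A[X])).prod).coeff k = listEsymm L k := by
  induction L generalizing k with
  | nil => cases k <;> simp [coeff_one]
  | cons a L ih =>
    rw [List.map_cons, List.prod_cons, add_mul, one_mul, coeff_add, ih]
    cases k with
    | zero => simp [mul_assoc]
    | succ k => rw [mul_assoc, coeff_X_mul, coeff_C_mul, ih, listEsymm_cons_succ]

lemma SatisfiesRelations.map {L : List A} (h : SatisfiesRelations L) (f : A →+* B) :
    SatisfiesRelations (L.map f) := by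
  induction L with
  | nil => trivial
  | cons c M ih =>
    obtain ⟨h1, h2, h3⟩ := h
    refine ⟨?_, ?_, ih h3⟩
    · simp only [List.forall_mem_map]
      intro a ha
      simpa using congrArg f (h1 a ha)
    · rw [List.pairwise_map]
      refine h2.imp fun {b a} h => ⟨?_, ?_⟩
      · simpa using congrArg f h.1
      · simpa using congrArg f h.2

/-- The noncommutative elementary symmetric functions commute under the relations of `I_C`. -/
theorem listEsymm_comm (L : List A) (h : SatisfiesRelations L) (k l : ℕ) :
    listEsymm L k * listEsymm L l = listEsymm L l * listEsymm L k := by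
  -- `linearProd` takes scalars in a commutative ring, and `A[X]` need not be commutative. The two
  -- indeterminates are therefore taken as elements of the centre of `A[X][X]`.
  have hy : (X : A[X][X]) ∈ Subring.center A[X][X] := by
    rw [Subring.mem_center_iff]
    exact fun p => (X_mul (p := p)).symm
  have hx : (C X : A[X][X]) ∈ Subring.center A[X][X] := by
    rw [Subring.mem_center_iff]
    intro p
    ext n : 1
    rw [coeff_mul_C, coeff_C_mul, X_mul]
  set L' : List A[X][X] := L.map ((C : A[X] →+* A[X][X]).comp C) with hL'
  set p : A[X] := (L.map fun a => (1 + X * C a : A[X])).prod with hp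
  have h1 : linearProd (⟨C X, hx⟩ : Subring.center A[X][X]) L' = C p := by
    rw [linearProd, hL', hp, map_list_prod, List.map_map, List.map_map]
    congr 1
    refine List.map_congr_left fun a _ => ?_
    have hXa : (C X * C (C a) : A[X][X]) = C (C a) * C X := by rw [← C_mul, ← C_mul, X_mul]
    simp [Subring.smul_def, hXa]
  have h2 : linearProd (⟨X, hy⟩ : Subring.center A[X][X]) L' = p.map C := by
    rw [linearProd, hL', hp, ← coe_mapRingHom, map_list_prod, List.map_map, List.map_map]
    congr 1
    refine List.map_congr_left fun a _ => ?_
    simp [Subring.smul_def]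
  have h3 := linearProd_comm (⟨C X, hx⟩ : Subring.center A[X][X]) ⟨X, hy⟩ L'
    (h.map ((C : A[X] →+* A[X][X]).comp C))
  rw [h1, h2] at h3
  have h4 := congrArg (fun q : A[X][X] => (q.coeff l).coeff k) h3
  simpa only [coeff_C_mul, coeff_mul_C, coeff_map, hp, coeff_prod_one_add_X_mul_C] using h4

end ListEsymm
end NCSchur

/-! ### Word coefficients and the identity E(-x)H(x) = 1 -/

namespace NCSchur

variable {N : ℕ}

/-- The coefficient of a word, as an additive homomorphism. -/
noncomputable def coeffWordHom (w : FreeMonoid (Fin N)) : U N →+ ℤ where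
  toFun := coeffWord w
  map_zero' := by simp [coeffWord]
  map_add' := by simp [coeffWord]

lemma coeffWordHom_apply (w : FreeMonoid (Fin N)) (z : U N) :
    coeffWordHom w z = coeffWord w z := rfl

lemma ext_coeffWord {z z' : U N} (h : ∀ w, coeffWord w z = coeffWord w z') : z = z' := by
  apply FreeAlgebra.equivMonoidAlgebraFreeMonoid.injective
  apply MonoidAlgebra.coeff_injective
  ext w
  exact h w

lemma equiv_prod_u (l : List (Fin N)) :
    FreeAlgebra.equivMonoidAlgebraFreeMonoid (l.map u).prod
      = MonoidAlgebra.single (FreeMonoid.ofList l) (1 : ℤ) := by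
  induction l with
  | nil => simp [MonoidAlgebra.one_def]
  | cons a l ih =>
    rw [List.map_cons, List.prod_cons, map_mul, ih]
    simp [FreeAlgebra.equivMonoidAlgebraFreeMonoid, MonoidAlgebra.of_apply,
      MonoidAlgebra.single_mul_single]

lemma coeffWord_prod_u (w : FreeMonoid (Fin N)) (l : List (Fin N)) :
    coeffWord w (l.map u).prod = if w.toList = l then 1 else 0 := by
  classical
  rw [coeffWord, equiv_prod_u, MonoidAlgebra.coeff_single, Finsupp.single_apply]
  congr 1
  simp only [eq_iff_iff]
  constructor
  · rintro rfl; rfl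
  · rintro rfl; rfl

lemma coeffWord_mul (w : FreeMonoid (Fin N)) (z z' : U N) :
    coeffWord w (z * z') = ∑ m ∈ Finset.range (w.toList.length + 1),
      coeffWord (FreeMonoid.ofList (w.toList.take m)) z *
        coeffWord (FreeMonoid.ofList (w.toList.drop m)) z' := by
  classical
  rw [coeffWord, map_mul, MonoidAlgebra.coeff_mul_antidiag _ _ _
    ((Finset.range (w.toList.length + 1)).image fun m =>
      (FreeMonoid.ofList (w.toList.take m), FreeMonoid.ofList (w.toList.drop m)))]
  · rw [Finset.sum_image]
    · rfl
    · intro m hm m' hm' h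
      simp only [Prod.mk.injEq] at h
      have := congrArg (fun v : FreeMonoid (Fin N) => v.toList.length) h.1
      simp only [FreeMonoid.toList_ofList, List.length_take] at this
      simp at hm hm'
      omega
  · rintro ⟨p, q⟩
    simp only [Finset.mem_image, Finset.mem_range, Prod.mk.injEq]
    constructor
    · rintro ⟨m, hm, rfl, rfl⟩
      rw [← FreeMonoid.ofList_append, List.take_append_drop]
      rfl
    · rintro rfl
      refine ⟨p.toList.length, by simp, ?_, ?_⟩ <;> simp

/-- A word coefficient of the sum of the monomials of degree `k` whose letters satisfy a
pairwise relation. -/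
lemma coeffWord_sum_pairwise (r : Fin N → Fin N → Prop) (k : ℕ) (P : (Fin k → Fin N) → Prop)
    [DecidablePred P] [DecidableRel r] (hP : ∀ i, P i ↔ (List.ofFn i).Pairwise r) (w : FreeMonoid (Fin N)) :
    coeffWord w (∑ i : Fin k → Fin N with P i, (List.ofFn fun j => u (i j)).prod)
      = if w.toList.length = k ∧ w.toList.Pairwise r then 1 else 0 := by
  rw [← coeffWordHom_apply, map_sum]
  have h : ∀ i : Fin k → Fin N, coeffWordHom w (List.ofFn fun j => u (i j)).prod
      = if w.toList = List.ofFn i then 1 else 0 := by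
    intro i
    rw [← coeffWord_prod_u, coeffWordHom_apply, List.map_ofFn]
    rfl
  simp only [h]
  split_ifs with hw
  · obtain ⟨rfl, hw⟩ := hw
    rw [Finset.sum_eq_single w.toList.get]
    · simp [List.ofFn_get]
    · intro i _ hi
      rw [if_neg]
      intro h'
      apply hi
      apply List.ofFn_injective
      rw [← h', List.ofFn_get]
    · intro h'
      exact absurd (by simpa only [Finset.mem_filter_univ, hP, List.ofFn_get] using hw) h'
  · refine Finset.sum_eq_zero fun i hi => ?_
    rw [if_neg]
    intro h'
    apply hw
    rw [h']
    exact ⟨by simp, (hP i).1 (by simpa using hi)⟩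

lemma strictAnti_iff_pairwise_ofFn {k : ℕ} (i : Fin k → Fin N) :
    StrictAnti i ↔ (List.ofFn i).Pairwise (· > ·) := by
  rw [List.pairwise_ofFn]; rfl

lemma monotone_iff_pairwise_ofFn {k : ℕ} (i : Fin k → Fin N) :
    Monotone i ↔ (List.ofFn i).Pairwise (· ≤ ·) := by
  rw [List.pairwise_ofFn, monotone_iff_forall_lt]

lemma coeffWord_elemNat (k : ℕ) (w : FreeMonoid (Fin N)) :
    coeffWord w (elemNat N k)
      = if w.toList.length = k ∧ w.toList.Pairwise (· > ·) then 1 else 0 :=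
  coeffWord_sum_pairwise _ k _ strictAnti_iff_pairwise_ofFn w

lemma coeffWord_homog (k : ℕ) (w : FreeMonoid (Fin N)) :
    coeffWord w (homog N k)
      = if w.toList.length = k ∧ w.toList.Pairwise (· ≤ ·) then 1 else 0 :=
  coeffWord_sum_pairwise _ k _ monotone_iff_pairwise_ofFn w

lemma elemNat_zero : elemNat N 0 = 1 := by
  classical
  simp [elemNat, Subsingleton.strictAnti]

lemma homog_zero : homog N 0 = 1 := by
  classical
  simp [homog, Subsingleton.monotone]

lemma sublistsLen_map {α β : Type*} (f : α → β) (k : ℕ) (L : List α) :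
    List.sublistsLen k (L.map f) = (List.sublistsLen k L).map (List.map f) := by
  induction L generalizing k with
  | nil => cases k <;> simp
  | cons a L ih => cases k <;> simp [List.sublistsLen_succ_cons, ih, Function.comp_def]

/-- The strictly decreasing words are the sublists of the decreasing list of all letters, each
arising once since that list has no repetitions. -/
lemma elemNat_eq_listEsymm (k : ℕ) :
    elemNat N k = listEsymm ((List.finRange N).reverse.map u) k := by
  classical
  apply ext_coeffWord
  intro w
  have hnd : (List.sublistsLen k (List.finRange N).reverse).Nodup :=
    List.nodup_sublistsLen k (List.nodup_reverse.2 (List.nodup_finRange N))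
  have h1 : listEsymm ((List.finRange N).reverse.map u) k
      = ∑ l ∈ (List.sublistsLen k (List.finRange N).reverse).toFinset,
          (l.map (u : Fin N → U N)).prod := by
    rw [List.sum_toFinset _ hnd, listEsymm, sublistsLen_map, List.map_map]
    rfl
  rw [h1, ← coeffWordHom_apply, ← coeffWordHom_apply, map_sum]
  simp only [coeffWordHom_apply, coeffWord_prod_u, coeffWord_elemNat]
  rw [Finset.sum_ite_eq]
  congr 1
  simp only [List.mem_toFinset, List.mem_sublistsLen, eq_iff_iff, and_comm (a := _ = k)]
  refine and_congr_left fun _ => ?_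
  have hs : (List.finRange N).reverse.Pairwise (· > ·) := by
    rw [List.pairwise_reverse]; exact List.pairwise_lt_finRange N
  constructor
  · intro h
    refine List.sublist_of_subperm_of_pairwise (r := (· > ·)) ?_ h hs
    exact List.subperm_of_subset (h.imp fun h => ne_of_gt h) fun x _ => by simp
  · intro h
    exact hs.sublist h

/-- The splittings of a nonempty word into a strictly decreasing and a weakly increasing part
cancel in pairs. -/
lemma sum_sign_decreasing_increasing (l : List (Fin N)) (hl : l.length ≠ 0) :
    ∑ m ∈ Finset.range (l.length + 1), (if (l.take m).Pairwise (· > ·) ∧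
      (l.drop m).Pairwise (· ≤ ·) then (-1 : ℤ) ^ m else 0) = 0 := by
  induction l with
  | nil => simp at hl
  | cons a l ih =>
    cases l with
    | nil => simp [Finset.sum_range_succ]
    | cons b l =>
      have ih := ih (by simp)
      rw [Finset.sum_range_succ']
      simp only [← List.isChain_iff_pairwise, List.take_succ_cons, List.drop_succ_cons,
        List.take_zero, List.drop_zero, List.isChain_cons_cons] at ih ⊢
      -- If a > b, the letter a must join the decreasing part, so the splittings of the word are
      -- those of its tail with opposite sign. If a ≤ b, only the splittings at 0 and 1 can survive,
      -- and they cancel.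
      by_cases hab : b < a
      · rw [if_neg (c := _ ∧ _ ∧ _) (by rintro ⟨-, h, -⟩; exact absurd hab (not_lt.2 h)), add_zero,
          ← neg_eq_zero, ← Finset.sum_neg_distrib]
        refine (Finset.sum_congr rfl fun m _ => ?_).trans ih
        have : (List.IsChain (· > ·) (a :: List.take m (b :: l))) ↔
            List.IsChain (· > ·) (List.take m (b :: l)) := by
          cases m <;> simp [hab]
        simp only [this]
        split_ifs <;> simp [pow_succ]
      · rw [List.length_cons, Finset.sum_range_succ', Finset.sum_eq_zero]
        · simp only [not_lt.1 hab, List.take_zero, List.drop_zero, true_and,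
            List.IsChain.nil, List.IsChain.singleton]
          split_ifs <;> simp
        · intro m _
          rw [if_neg]
          simp [hab]

/-- The identity `E(-x) H(x) = 1`. -/
lemma sum_elemNat_mul_homog {k : ℕ} (hk : k ≠ 0) :
    ∑ m ∈ Finset.range (k + 1), (-1 : ℤ) ^ m • (elemNat N m * homog N (k - m)) = 0 := by
  classical
  apply ext_coeffWord
  intro w
  rw [← coeffWordHom_apply, map_sum, ← coeffWordHom_apply, map_zero]
  have h1 : ∀ m ∈ Finset.range (k + 1), coeffWordHom w
      ((-1 : ℤ) ^ m • (elemNat N m * homog N (k - m)))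
      = if w.toList.length = k then (if (w.toList.take m).Pairwise (· > ·) ∧
        (w.toList.drop m).Pairwise (· ≤ ·) then (-1) ^ m else 0) else 0 := by
    intro m hm
    have hm' : m ≤ k := by simpa [Nat.lt_succ_iff] using hm
    rw [map_zsmul, coeffWordHom_apply, coeffWord_mul]
    simp only [coeffWord_elemNat, coeffWord_homog, FreeMonoid.toList_ofList, List.length_take,
      List.length_drop]
    by_cases hw : w.toList.length = k
    · rw [if_pos hw, Finset.sum_eq_single m]
      · rw [hw, min_eq_left hm']
        split_ifs <;> simp_all
      · intro b hb hbm
        rw [Finset.mem_range] at hb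
        rw [if_neg (by rintro ⟨h, -⟩; omega), zero_mul]
      · intro h
        rw [hw] at h
        exact absurd hm h
    · rw [if_neg hw, Finset.sum_eq_zero, smul_zero]
      intro b hb
      rw [Finset.mem_range] at hb
      by_cases hb' : b = m
      · rw [if_neg (c := _ ∧ List.Pairwise (· ≤ ·) _) (by rintro ⟨h, -⟩; omega), mul_zero]
      · rw [if_neg (by rintro ⟨h, -⟩; omega), zero_mul]
  rw [Finset.sum_congr rfl h1]
  split_ifs with hw
  · subst hw
    exact sum_sign_decreasing_increasing _ hk
  · simp
end NCSchur

/-! ### The commutative ring containing the images of e_k and h_k -/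

namespace NCSchur

variable {N : ℕ}

lemma listEsymm_map {A B : Type*} [Ring A] [Ring B] (f : A →+* B) (L : List A) (k : ℕ) :
    listEsymm (L.map f) k = f (listEsymm L k) := by
  rw [listEsymm, listEsymm, sublistsLen_map, map_list_sum, List.map_map, List.map_map]
  congr 1
  exact List.map_congr_left fun l _ => by simp [map_list_prod]

/-- The three families of generators, in order, are c[c,a] - [c,a]a (with c in place of the larger
letter), b[c,a] - [c,a]b and [c,b][c,a], expanded. -/
lemma satisfiesRelations_map_u {A : Type*} [Ring A] (f : U N →+* A)
    (hf : ∀ z ∈ relations N, f z = 0) (L : List (Fin N)) (hL : L.Pairwise (· > ·)) :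
    SatisfiesRelations (L.map fun i => f (u i)) := by
  induction L with
  | nil => trivial
  | cons c M ih =>
    rw [List.pairwise_cons] at hL
    refine ⟨?_, ?_, ih hL.2⟩
    · simp only [List.forall_mem_map]
      intro a ha
      have h := hf _ (Or.inl (Or.inl ⟨a, c, hL.1 a ha, rfl⟩))
      simp only [map_sub, map_add, map_mul] at h
      rw [← sub_eq_zero, ← h]
      noncomm_ring
    · rw [List.pairwise_map]
      refine hL.2.imp_of_mem fun {b a} hb ha hab => ⟨?_, ?_⟩
      · have h := hf _ (Or.inl (Or.inr ⟨a, b, c, hab, hL.1 b hb, rfl⟩))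
        simp only [map_sub, map_add, map_mul] at h
        rw [← sub_eq_zero, ← neg_eq_zero, ← h]
        noncomm_ring
      · have h := hf _ (Or.inr ⟨a, b, c, hab, hL.1 b hb, rfl⟩)
        simp only [map_sub, map_add, map_mul] at h
        rw [← h]
        noncomm_ring

lemma map_elemNat_comm {A : Type*} [Ring A] (f : U N →+* A)
    (hf : ∀ z ∈ relations N, f z = 0) (k l : ℕ) :
    f (elemNat N k) * f (elemNat N l) = f (elemNat N l) * f (elemNat N k) := by
  rw [elemNat_eq_listEsymm, elemNat_eq_listEsymm, ← listEsymm_map, ← listEsymm_map]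
  apply listEsymm_comm
  rw [List.map_map]
  apply satisfiesRelations_map_u f hf
  rw [List.pairwise_reverse]
  exact List.pairwise_lt_finRange N

open scoped IsMulCommutative in
/-- The images of the `e_k(u)` and `h_l(u)` in a ring where the relations of `I_C` hold lie in a
commutative subring. -/
theorem exists_commRing_lift {A : Type} [Ring A] (f : U N →+* A)
    (hf : ∀ z ∈ relations N, f z = 0) :
    ∃ (C : Type) (_ : CommRing C) (φ : C →+* A) (h e : ℕ → C),
      (∀ k, φ (h k) = f (homog N k)) ∧ (∀ k, φ (e k) = f (elemNat N k)) ∧ h 0 = 1 ∧ e 0 = 1 ∧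
      ∀ k, k ≠ 0 → ∑ m ∈ Finset.range (k + 1), (-1) ^ m * (e m * h (k - m)) = 0 := by
  set s : Set A := Set.range fun k => f (elemNat N k) with hs
  have hcomm : ∀ x ∈ s, ∀ y ∈ s, x * y = y * x := by
    rintro _ ⟨k, rfl⟩ _ ⟨l, rfl⟩
    exact map_elemNat_comm f hf k l
  have he : ∀ k, f (elemNat N k) ∈ Subring.closure s := fun k => Subring.subset_closure ⟨k, rfl⟩
  have hrec : ∀ k, k ≠ 0 → ∑ m ∈ Finset.range (k + 1),
      (-1 : A) ^ m * (f (elemNat N m) * f (homog N (k - m))) = 0 := by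
    intro k hk
    have := congrArg f (sum_elemNat_mul_homog (N := N) hk)
    rw [map_sum, map_zero] at this
    rw [← this]
    refine Finset.sum_congr rfl fun m _ => ?_
    simp [zsmul_eq_mul]
  -- The term m = 0 of E(-x)H(x) = 1 isolates h_k, leaving e's and earlier h's.
  have hh : ∀ k, f (homog N k) ∈ Subring.closure s := by
    intro k
    induction k using Nat.strong_induction_on with
    | _ k ih =>
      by_cases hk : k = 0
      · subst hk
        rw [homog_zero, map_one]
        exact one_mem _
      · have := hrec k hk
        rw [Finset.sum_range_succ'] at this
        simp only [pow_zero, one_mul, elemNat_zero, map_one, Nat.sub_zero] at this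
        rw [eq_neg_of_add_eq_zero_right this]
        refine neg_mem (sum_mem fun m hm => ?_)
        rw [Finset.mem_range] at hm
        exact mul_mem (pow_mem (neg_mem (one_mem _)) _) (mul_mem (he _) (ih _ (by omega)))
  have := Subring.isMulCommutative_closure hcomm
  refine ⟨Subring.closure s, inferInstance, (Subring.closure s).subtype,
    fun k => ⟨_, hh k⟩, fun k => ⟨_, he k⟩, fun k => rfl, fun k => rfl, ?_, ?_, ?_⟩
  · exact Subtype.ext (by simp [homog_zero])
  · exact Subtype.ext (by simp [elemNat_zero])
  · intro k hk
    apply Subtype.ext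
    have := hrec k hk
    refine Eq.trans ?_ this
    push_cast
    rfl
end NCSchur

/-! ### The Cauchy product and fundamental quasisymmetric functions -/

namespace NCSchur

variable {N : ℕ}

lemma coeff_seriesH {σ : Type} [DecidableEq σ] (j : σ) (d : σ →₀ ℕ) :
    MvPowerSeries.coeff d (seriesH N j) = if d.support ⊆ {j} then homog N (d j) else 0 := rfl

lemma coeff_seriesH_single {σ : Type} [DecidableEq σ] (j : σ) (m : ℕ) :
    MvPowerSeries.coeff (Finsupp.single j m) (seriesH N j) = homog N m := by
  rw [coeff_seriesH, if_pos Finsupp.support_single_subset, Finsupp.single_eq_same]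

/-- As f does not involve x_j and the other factor involves nothing else, just one splitting of d
contributes. -/
lemma coeff_mul_seriesH {σ : Type} [DecidableEq σ] (f : MvPowerSeries σ (U N)) (j : σ)
    (hf : ∀ d : σ →₀ ℕ, d j ≠ 0 → MvPowerSeries.coeff d f = 0) (d : σ →₀ ℕ) :
    MvPowerSeries.coeff d (f * seriesH N j)
      = MvPowerSeries.coeff (d.erase j) f * homog N (d j) := by
  classical
  rw [MvPowerSeries.coeff_mul, Finset.sum_eq_single (d.erase j, Finsupp.single j (d j))]
  · rw [coeff_seriesH_single]
  · rintro ⟨p, q⟩ hpq hne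
    rw [Finset.HasAntidiagonal.mem_antidiagonal] at hpq
    simp only at hpq ⊢
    by_cases hp : p j = 0
    · rw [coeff_seriesH, if_neg, mul_zero]
      intro hq
      apply hne
      have hq' : q = Finsupp.single j (d j) := by
        ext m
        by_cases hm : m = j
        · subst hm
          have := DFunLike.congr_fun hpq m
          simp only [Finsupp.add_apply, hp, zero_add] at this
          simp [this]
        · rw [Finsupp.single_eq_of_ne hm]
          by_contra hc
          exact hm (by simpa using hq (Finsupp.mem_support_iff.2 hc))
      have hp' : p = d.erase j := by
        ext m
        by_cases hm : m = j
        · subst hm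
          simp [hp]
        · have := DFunLike.congr_fun hpq m
          rw [Finsupp.erase_ne hm, ← this, hq']
          simp [Finsupp.single_eq_of_ne hm]
      rw [hp', hq']
    · rw [hf p hp, zero_mul]
  · intro h
    rw [Finset.HasAntidiagonal.mem_antidiagonal] at h
    exact absurd (Finsupp.erase_add_single j d) h

lemma partialCauchy_succ (n : ℕ) :
    partialCauchy N (n + 1) = partialCauchy N n * seriesH N n := by
  simp [partialCauchy, List.range_succ]

lemma coeff_partialCauchy_eq_zero (n : ℕ) (d : ℕ →₀ ℕ) (j : ℕ) (hj : n ≤ j) (h : d j ≠ 0) :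
    MvPowerSeries.coeff d (partialCauchy N n) = 0 := by
  induction n generalizing d j with
  | zero =>
    classical
    rw [partialCauchy, List.range_zero, List.map_nil, List.prod_nil, MvPowerSeries.coeff_one,
      if_neg]
    rintro rfl
    exact h rfl
  | succ n ih =>
    rw [partialCauchy_succ, coeff_mul_seriesH _ _ fun d hd => ih d n le_rfl hd,
      ih _ j (by omega) (by rwa [Finsupp.erase_ne (by omega)]), zero_mul]

lemma coeff_partialCauchy_eq_prod (n : ℕ) (d : ℕ →₀ ℕ) (h : ∀ j, n ≤ j → d j = 0) :
    MvPowerSeries.coeff d (partialCauchy N n)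
      = ((List.range n).map fun j => homog N (d j)).prod := by
  induction n generalizing d with
  | zero =>
    have : d = 0 := by ext j; exact h j (by omega)
    subst this
    simp [partialCauchy]
  | succ n ih =>
    rw [partialCauchy_succ, coeff_mul_seriesH _ _
      fun d hd => coeff_partialCauchy_eq_zero n d n le_rfl hd, ih]
    · rw [List.range_succ, List.map_append, List.prod_append, List.map_singleton,
        List.prod_singleton]
      congr 2
      refine List.map_congr_left fun j hj => ?_
      rw [List.mem_range] at hj
      rw [Finsupp.erase_ne (by omega)]
    · intro j hj
      by_cases hjn : j = n
      · subst hjn; simp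
      · rw [Finsupp.erase_ne hjn, h j (by omega)]

lemma coeff_cauchyProduct (n : ℕ) (d : ℕ →₀ ℕ) (h : ∀ j, n ≤ j → d j = 0) :
    MvPowerSeries.coeff d (cauchyProduct N)
      = ((List.range n).map fun j => homog N (d j)).prod := by
  rw [← coeff_partialCauchy N n d h, coeff_partialCauchy_eq_prod n d h]

lemma exists_forall_ge_eq_zero (d : ℕ →₀ ℕ) : ∃ n, ∀ j, n ≤ j → d j = 0 := by
  refine ⟨d.support.sup id + 1, fun j hj => ?_⟩
  by_contra hc
  have := Finset.le_sup (f := id) (Finsupp.mem_support_iff.2 hc)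
  simp only [id] at this
  omega

/-- The weakly increasing list of the indices `j < n`, each with multiplicity `d j`. -/
def sortedIndices (n : ℕ) (d : ℕ → ℕ) : List ℕ :=
  (List.range n).flatMap fun j => List.replicate (d j) j

lemma sortedIndices_succ (n : ℕ) (d : ℕ → ℕ) :
    sortedIndices (n + 1) d = sortedIndices n d ++ List.replicate (d n) n := by
  simp [sortedIndices, List.range_succ]

lemma lt_of_mem_sortedIndices {n : ℕ} {d : ℕ → ℕ} {j : ℕ} (h : j ∈ sortedIndices n d) : j < n := by
  simp only [sortedIndices, List.mem_flatMap, List.mem_range, List.mem_replicate] at h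
  obtain ⟨a, ha, -, rfl⟩ := h
  exact ha

lemma pairwise_sortedIndices (n : ℕ) (d : ℕ → ℕ) : (sortedIndices n d).Pairwise (· ≤ ·) := by
  induction n with
  | zero => simp [sortedIndices]
  | succ n ih =>
    rw [sortedIndices_succ, List.pairwise_append]
    refine ⟨ih, by simp [List.pairwise_replicate], fun a ha b hb => ?_⟩
    rw [List.eq_of_mem_replicate hb]
    exact (lt_of_mem_sortedIndices ha).le

lemma count_sortedIndices (n : ℕ) (d : ℕ → ℕ) (h : ∀ j, n ≤ j → d j = 0) (j : ℕ) :
    (sortedIndices n d).count j = d j := by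
  have key : ∀ n, (sortedIndices n d).count j = if j < n then d j else 0 := by
    intro n
    induction n with
    | zero => simp [sortedIndices]
    | succ n ih =>
      rw [sortedIndices_succ, List.count_append, ih, List.count_replicate]
      by_cases hj : j = n
      · subst hj; simp
      · have : (j < n + 1) = (j < n) := by rw [eq_iff_iff]; omega
        simp [Ne.symm hj, this]
  rw [key]
  split_ifs with hj
  · rfl
  · exact (h j (by omega)).symm

/-- The lexicographic order on pairs of a letter and an index, where the index is compared
first. -/
def BiletterLE (p q : Fin N × ℕ) : Prop := p.2 < q.2 ∨ (p.2 = q.2 ∧ p.1 ≤ q.1)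

instance : IsTrans (Fin N × ℕ) BiletterLE where
  trans := by
    rintro ⟨a, i⟩ ⟨b, j⟩ ⟨c, k⟩ h h'
    simp only [BiletterLE] at *
    omega

-- The lengths d_0, d_1, … force how the word is cut into blocks, and each block must increase
-- weakly. Writing the block number under each letter turns this into sortedness of a biword.
open Classical in
lemma coeffWord_prod_homog (n : ℕ) (d : ℕ → ℕ) (w : List (Fin N)) :
    coeffWord (FreeMonoid.ofList w) ((List.range n).map fun j => homog N (d j)).prod
      = if w.length = (sortedIndices n d).length ∧
          (w.zip (sortedIndices n d)).Pairwise BiletterLE then 1 else 0 := by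
  induction n generalizing w with
  | zero =>
    have := coeffWord_prod_u (FreeMonoid.ofList w) []
    simp only [List.map_nil, List.prod_nil] at this
    by_cases hw : w = []
    · subst hw
      simpa [sortedIndices] using this
    · simp [sortedIndices, this, hw]
  | succ n ih =>
    rw [List.range_succ, List.map_append, List.prod_append, List.map_singleton,
      List.prod_singleton, coeffWord_mul, FreeMonoid.toList_ofList]
    simp only [ih, coeffWord_homog, FreeMonoid.toList_ofList]
    set s := sortedIndices n d with hs
    have hrep : ∀ l : List (Fin N), (l.zip (List.replicate l.length n)) = l.map fun a => (a, n) := by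
      intro l
      induction l with
      | nil => rfl
      | cons a l ih => simp [List.replicate_succ, ih]
    have hP : w.length = (s ++ List.replicate (d n) n).length →
        ((w.zip (s ++ List.replicate (d n) n)).Pairwise BiletterLE ↔
          ((w.take s.length).zip s).Pairwise BiletterLE ∧ (w.drop s.length).Pairwise (· ≤ ·)) := by
      intro hw
      rw [List.length_append, List.length_replicate] at hw
      have h1 : (w.drop s.length).length = d n := by rw [List.length_drop]; omega
      have h2 : (w.take s.length).length = s.length := by rw [List.length_take]; omega
      conv_lhs => rw [← List.take_append_drop s.length w, List.zip_append h2, ← h1, hrep,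
        List.pairwise_append, List.pairwise_map]
      simp only [BiletterLE, lt_irrefl, false_or, true_and]
      constructor
      · exact fun h => ⟨h.1, h.2.1⟩
      · refine fun h => ⟨h.1, h.2, fun p hp q hq => Or.inl ?_⟩
        obtain ⟨a, -, rfl⟩ := List.mem_map.1 hq
        exact lt_of_mem_sortedIndices (List.of_mem_zip (a := p.1) (b := p.2) hp).2
    rw [sortedIndices_succ, ← hs]
    by_cases hw : w.length = (s ++ List.replicate (d n) n).length
    · rw [Finset.sum_eq_single s.length]
      · simp only [hw, hP hw]
        simp
        split_ifs <;> simp_all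
      · intro m hm hms
        rw [Finset.mem_range] at hm
        rw [if_neg (by rintro ⟨h, -⟩; rw [List.length_take] at h; omega), zero_mul]
      · intro h
        simp [hw] at h
    · rw [if_neg (fun h => hw h.1)]
      refine Finset.sum_eq_zero fun m hm => ?_
      rw [Finset.mem_range] at hm
      rw [List.length_append, List.length_replicate] at hw
      by_cases hm' : (w.take m).length = s.length
      · refine mul_eq_zero_of_right _ (if_neg ?_)
        rintro ⟨h, -⟩
        rw [List.length_drop] at h
        rw [List.length_take] at hm'
        omega
      · rw [if_neg (fun h => hm' h.1), zero_mul]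

/-- By transitivity only neighbours matter, and an equal index is allowed there exactly when the
word has no descent. -/
lemma pairwise_biletterLE_iff (w : List (Fin N)) (i : Fin w.length → ℕ) :
    (w.zip (List.ofFn i)).Pairwise BiletterLE ↔ Monotone i ∧
      ∀ j, ∀ h : j + 1 < w.length, j ∈ descents w → i ⟨j, by omega⟩ < i ⟨j + 1, h⟩ := by
  constructor
  · intro h
    rw [List.pairwise_iff_getElem] at h
    simp only [List.length_zip, List.length_ofFn, min_self, List.getElem_zip, List.getElem_ofFn,
      BiletterLE] at h
    refine ⟨?_, ?_⟩
    · rw [monotone_iff_forall_lt]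
      rintro ⟨a, ha⟩ ⟨b, hb⟩ hab
      have := h a b ha hb hab
      omega
    · rintro j hj ⟨h', hlt⟩
      have := h j (j + 1) (by omega) hj (by omega)
      omega
  · rintro ⟨hm, hd⟩
    rw [← List.isChain_iff_pairwise, List.isChain_iff_getElem]
    simp only [List.length_zip, List.length_ofFn, min_self, List.getElem_zip, List.getElem_ofFn,
      BiletterLE]
    intro j hj
    have h1 : i ⟨j, by omega⟩ ≤ i ⟨j + 1, hj⟩ := hm (by simp [Fin.le_def])
    by_cases hdj : j ∈ descents w
    · exact Or.inl (hd j hj hdj)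
    · have : w[j] ≤ w[j + 1] := by
        by_contra hc
        exact hdj ⟨hj, not_le.1 hc⟩
      omega

lemma count_ofFn {n : ℕ} (i : Fin n → ℕ) (j : ℕ) :
    (List.ofFn i).count j = (∑ k, Finsupp.single (i k) 1 : ℕ →₀ ℕ) j := by
  induction n with
  | zero => simp
  | succ n ih =>
    rw [List.ofFn_succ, List.count_cons, ih, Fin.sum_univ_succ, Finsupp.add_apply, add_comm]
    simp [Finsupp.single_apply]

-- A weakly increasing sequence is determined by its content, so `sortedIndices n d` is the only
-- candidate and the count is 0 or 1.
open Classical in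
lemma fundamentalQ_descents_apply (n : ℕ) (d : ℕ →₀ ℕ) (h : ∀ j, n ≤ j → d j = 0)
    (w : List (Fin N)) :
    fundamentalQ w.length (descents w) d
      = if w.length = (sortedIndices n d).length ∧
          (w.zip (sortedIndices n d)).Pairwise BiletterLE then 1 else 0 := by
  have huniq : ∀ i : Fin w.length → ℕ, Monotone i → ∑ k, Finsupp.single (i k) 1 = d →
      List.ofFn i = sortedIndices n d := by
    intro i hi hd
    refine List.Perm.eq_of_pairwise (le := (· ≤ ·)) (fun a b _ _ => le_antisymm) ?_
      (pairwise_sortedIndices n d) ?_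
    · rw [List.pairwise_ofFn]
      exact fun a b hab => hi hab.le
    · rw [List.perm_iff_count]
      intro j
      rw [count_ofFn, hd, count_sortedIndices n d h]
  change ((Nat.card _ : ℕ) : ℤ) = _
  split_ifs with hw
  · rw [Nat.cast_eq_one, Nat.card_eq_one_iff_unique]
    have hof : List.ofFn (fun k : Fin w.length => (sortedIndices n d)[k]'(hw.1 ▸ k.2))
        = sortedIndices n d := by
      apply List.ext_getElem <;> simp [hw.1]
    have h1 := (pairwise_biletterLE_iff w _).1 (hof.symm ▸ hw.2)
    refine ⟨⟨?_⟩, ⟨⟨_, h1.1, h1.2, ?_⟩⟩⟩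
    · rintro ⟨i, hi, -, hd⟩ ⟨i', hi', -, hd'⟩
      exact Subtype.ext (List.ofFn_injective ((huniq i hi hd).trans (huniq i' hi' hd').symm))
    · ext j
      rw [← count_ofFn, hof, count_sortedIndices n d h]
  · rw [Nat.cast_eq_zero]
    have : IsEmpty {i : Fin w.length → ℕ // Monotone i ∧
        (∀ j, ∀ h : j + 1 < w.length, j ∈ descents w → i ⟨j, by omega⟩ < i ⟨j + 1, h⟩) ∧
        ∑ j, Finsupp.single (i j) 1 = d} := by
      refine ⟨?_⟩
      rintro ⟨i, hi, hi', hd⟩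
      have h2 := huniq i hi hd
      apply hw
      rw [← h2]
      exact ⟨by simp, (pairwise_biletterLE_iff w i).2 ⟨hi, hi'⟩⟩
    exact Nat.card_of_isEmpty

theorem F_eq_sum_fundamentalQ (γ : UDual N) :
    F γ = ∑ w ∈ γ.support, γ w • fundamentalQ w.toList.length (descents w.toList) := by
  ext d
  obtain ⟨n, hn⟩ := exists_forall_ge_eq_zero d
  rw [map_sum]
  change pairing (MvPowerSeries.coeff d (cauchyProduct N)) γ = _
  rw [pairing, Finsupp.sum]
  refine Finset.sum_congr rfl fun w _ => ?_
  change _ = γ w * fundamentalQ w.toList.length (descents w.toList) d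
  rw [fundamentalQ_descents_apply n d hn, coeff_cauchyProduct n d hn]
  exact congrArg _ (coeffWord_prod_homog n d w.toList)

end NCSchur

/-! ### A Pieri rule for Toeplitz determinants -/

namespace NCSchur

section Pieri

open Polynomial

variable {R : Type*} [CommRing R]

/-- The determinant of the matrix with entries `e (α i + j - i)`. -/
def toeplitzDet (e : ℤ → R) {T : ℕ} (α : Fin T → ℤ) : R :=
  (Matrix.of fun i j : Fin T => e (α i + (j : ℕ) - (i : ℕ))).det

lemma det_add_smul_eq_sum {n : Type*} [Fintype n] [DecidableEq n] (A B : Matrix n n R) (x : R) :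
    (A + x • B).det = ∑ S : Finset n, x ^ S.card *
      (Matrix.of fun i j => if i ∈ S then B i j else A i j).det := by
  rw [add_comm]
  have h := (Matrix.detRowAlternating (n := n) (R := R)).toMultilinearMap.map_add_univ (x • B) A
  refine h.trans (Finset.sum_congr rfl fun S _ => ?_)
  have h2 := (Matrix.detRowAlternating (n := n) (R := R)).toMultilinearMap.map_piecewise_smul
    (fun _ => x) (Matrix.of fun i j => if i ∈ S then B i j else A i j) S
  rw [Finset.prod_const, smul_eq_mul] at h2
  refine Eq.trans ?_ h2
  congr 1
  ext i j
  unfold Finset.piecewise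
  by_cases hi : i ∈ S
  · simp only [if_pos hi]
    exact congrArg (x * ·) (if_pos hi).symm
  · simp only [if_neg hi]
    exact (if_neg hi).symm

lemma sum_telescoping (x : R) (a : ℕ → R) (j T : ℕ) (hj : j ≤ T) :
    ∑ m ∈ Finset.range T, (if j ≤ m then (-x) ^ (m - j) * (a m + x * a (m + 1)) else 0)
      = a j - (-x) ^ (T - j) * a T := by
  induction T, hj using Nat.le_induction with
  | base =>
    rw [Finset.sum_eq_zero]
    · simp
    · intro m hm
      rw [Finset.mem_range] at hm
      rw [if_neg (by omega)]
  | succ T hT ih =>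
    rw [Finset.sum_range_succ, ih, if_pos hT, Nat.succ_sub hT, pow_succ]
    ring

/-- Let a_0, …, a_T be the columns of the Toeplitz matrix A prolonged by one. The matrix here has
columns a_j + X a_{j+1}; the unitriangular V telescopes them to a_j - (-X)^{T-j} a_T. The recursion
expresses a_T through the columns of A, so the product is A times a rank-one perturbation of the
identity, whose determinant is ∑ h_m X^m. -/
lemma det_toeplitz_add_X_smul (e : ℤ → R) (h : ℕ → R) (T : ℕ) (h0 : h 0 = 1)
    (he : ∀ n : ℤ, 0 < n →
      e n = ∑ m ∈ Finset.range T, (-1) ^ m * h (m + 1) * e (n - 1 - m))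
    (α : Fin T → ℤ) (hα : ∀ i, 0 ≤ α i) :
    (Matrix.of fun i j : Fin T => (C (e (α i + (j : ℕ) - (i : ℕ)))
      + X * C (e (α i + (j : ℕ) + 1 - (i : ℕ))) : R[X])).det
      = C (toeplitzDet e α) * ∑ m ∈ Finset.range (T + 1), C (h m) * X ^ m := by
  set M : Matrix (Fin T) (Fin T) R[X] := Matrix.of fun i j : Fin T =>
    (C (e (α i + (j : ℕ) - (i : ℕ))) + X * C (e (α i + (j : ℕ) + 1 - (i : ℕ))) : R[X]) with hM
  set A : Matrix (Fin T) (Fin T) R[X] := Matrix.of fun i j : Fin T =>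
    C (e (α i + (j : ℕ) - (i : ℕ))) with hA
  set V : Matrix (Fin T) (Fin T) R[X] := Matrix.of fun m j : Fin T =>
    if (j : ℕ) ≤ m then (-X) ^ ((m : ℕ) - j) else 0 with hV
  set c : Fin T → R[X] := fun j => (-1) ^ (T - 1 - (j : ℕ)) * C (h (T - j)) with hc
  set v : Fin T → R[X] := fun j => (-X) ^ (T - (j : ℕ)) with hv
  have hdetV : V.det = 1 := by
    rw [Matrix.det_of_isLowerTriangular]
    · simp [hV]
    · intro i j hij
      have : ¬ j ≤ i := not_le.2 hij
      simp [hV, this]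
  have hdetA : A.det = C (toeplitzDet e α) := by
    rw [toeplitzDet, RingHom.map_det]
    rfl
  -- The recursion applies because α i ≥ 0 and i < T make the index positive.
  have hlast : ∀ i : Fin T, C (e (α i + T - (i : ℕ))) = ∑ l, A i l * c l := by
    intro i
    have hi := i.2
    have hαi := hα i
    rw [he _ (by omega), ← Finset.sum_range_reflect, map_sum, Finset.sum_range]
    refine Finset.sum_congr rfl fun l _ => ?_
    have hl := l.2
    have h1 : T - 1 - (l : ℕ) + 1 = T - l := by omega
    have h2 : α i + T - (i : ℕ) - 1 - ((T - 1 - (l : ℕ) : ℕ) : ℤ) = α i + (l : ℕ) - (i : ℕ) := by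
      omega
    rw [h1, h2]
    simp only [hA, hc, Matrix.of_apply, map_mul, map_pow, map_neg, map_one]
    ring
  have hMV : M * V = A * (1 - Matrix.replicateCol Unit c * Matrix.replicateRow Unit v) := by
    ext1 i j
    rw [Matrix.mul_apply, mul_sub, mul_one, ← Matrix.mul_assoc, Matrix.sub_apply,
      Matrix.mul_apply (M := A * _)]
    have h1 := sum_telescoping (X : R[X]) (fun m => C (e (α i + m - (i : ℕ)))) j T j.2.le
    rw [Finset.sum_range] at h1
    have h2 : ∑ l, M i l * V l j = ∑ m : Fin T, (if (j : ℕ) ≤ m then (-X : R[X]) ^ ((m : ℕ) - j) *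
        (C (e (α i + (m : ℕ) - (i : ℕ))) + X * C (e (α i + ((m : ℕ) + 1 : ℕ) - (i : ℕ)))) else 0) := by
      refine Finset.sum_congr rfl fun m _ => ?_
      simp only [hM, hV, Matrix.of_apply]
      split_ifs
      · rw [mul_comm]
        push_cast
        rw [add_assoc (α i)]
      · rw [mul_zero]
    rw [h2, h1, hlast i]
    simp only [Finset.univ_unique, Finset.sum_singleton, Matrix.replicateRow_apply,
      Matrix.mul_apply, Matrix.replicateCol_apply, hv]
    rw [mul_comm (_ ^ _)]
    rfl
  have hdet := congrArg Matrix.det hMV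
  rw [Matrix.det_mul, Matrix.det_mul, hdetV, mul_one, hdetA] at hdet
  rw [hdet]
  congr 1
  have h3 : (1 - Matrix.replicateCol Unit c * Matrix.replicateRow Unit v)
      = 1 + Matrix.replicateCol Unit c * Matrix.replicateRow Unit (-v) := by
    ext i j
    simp [Matrix.mul_apply, sub_eq_add_neg]
  rw [h3, Matrix.det_one_add_replicateCol_mul_replicateRow, Finset.sum_range_succ', add_comm]
  congr 1
  · rw [dotProduct, ← Finset.sum_range_reflect, Finset.sum_range]
    refine Finset.sum_congr rfl fun l _ => ?_
    have hl := l.2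
    have h4 : T - 1 - (l : ℕ) + 1 = T - l := by omega
    simp only [hc, hv, Pi.neg_apply, h4]
    rw [neg_pow, ← h4, pow_succ]
    have h5 : ((-1 : R[X]) ^ (T - 1 - (l : ℕ))) * (-1) ^ (T - 1 - (l : ℕ)) = 1 := by
      rw [← mul_pow]; simp
    linear_combination (C (h (T - 1 - l + 1)) * X ^ (T - 1 - (l : ℕ) + 1)) * h5
  · simp [h0]

/-- The Pieri rule for Toeplitz determinants, before the vanishing terms are discarded. -/
theorem toeplitzDet_mul_eq_sum (e : ℤ → R) (h : ℕ → R) (T : ℕ) (h0 : h 0 = 1)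
    (he : ∀ n : ℤ, 0 < n →
      e n = ∑ m ∈ Finset.range T, (-1) ^ m * h (m + 1) * e (n - 1 - m))
    (α : Fin T → ℤ) (hα : ∀ i, 0 ≤ α i) (k : ℕ) (hk : k ≤ T) :
    toeplitzDet e α * h k = ∑ S ∈ Finset.powersetCard k (Finset.univ : Finset (Fin T)),
      toeplitzDet e (fun i => α i + if i ∈ S then 1 else 0) := by
  have h1 := det_toeplitz_add_X_smul e h T h0 he α hα
  have h2 := det_add_smul_eq_sum
    (Matrix.of fun i j : Fin T => (C (e (α i + (j : ℕ) - (i : ℕ))) : R[X]))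
    (Matrix.of fun i j : Fin T => (C (e (α i + (j : ℕ) + 1 - (i : ℕ))) : R[X])) X
  have h3 := congrArg (fun p => coeff p k) (h2.symm.trans h1)
  -- Shifting row i one column to the right amounts to raising α i by one.
  have h4 : ∀ S : Finset (Fin T), (Matrix.of fun i j : Fin T => if i ∈ S then
      (Matrix.of fun i j : Fin T => (C (e (α i + (j : ℕ) + 1 - (i : ℕ))) : R[X])) i j else
      (Matrix.of fun i j : Fin T => (C (e (α i + (j : ℕ) - (i : ℕ))) : R[X])) i j).det
      = C (toeplitzDet e (fun i => α i + if i ∈ S then 1 else 0)) := by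
    intro S
    rw [toeplitzDet, RingHom.map_det]
    congr 1
    ext1 i j
    simp only [Matrix.of_apply, RingHom.mapMatrix_apply, Matrix.map_apply]
    split_ifs
    · congr 3; ring
    · congr 3; ring
  simp only [h4, finsetSum_coeff, coeff_C_mul, coeff_X_pow, mul_ite, mul_one, mul_zero,
    X_pow_mul, Finset.sum_ite_eq, Finset.mem_range, Nat.lt_succ_iff.2 hk, if_true] at h3
  rw [← h3, ← Finset.sum_filter]
  refine Finset.sum_congr ?_ fun _ _ => rfl
  ext S
  simp [Finset.mem_powersetCard, eq_comm]

end Pieri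
end NCSchur

/-! ### Young diagrams, horizontal strips and Jacobi–Trudi determinants -/

namespace NCSchur

lemma YoungDiagram.colLen_le_card (μ : YoungDiagram) (j : ℕ) : μ.colLen j ≤ μ.card := by
  rw [YoungDiagram.colLen_eq_card]
  exact Finset.card_le_card (Finset.filter_subset _ _)

lemma YoungDiagram.rowLen_le_card (μ : YoungDiagram) (i : ℕ) : μ.rowLen i ≤ μ.card := by
  rw [YoungDiagram.rowLen_eq_card]
  exact Finset.card_le_card (Finset.filter_subset _ _)

lemma YoungDiagram.finite_card_le (n : ℕ) : {μ : YoungDiagram | μ.card ≤ n}.Finite := by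
  refine Set.Finite.subset (Set.Finite.preimage (f := YoungDiagram.cells)
    (fun μ _ ν _ h => YoungDiagram.ext h)
    ((Finset.range n ×ˢ Finset.range n).powerset.finite_toSet)) ?_
  intro μ hμ
  simp only [Set.mem_preimage, Finset.mem_coe, Finset.mem_powerset]
  rintro ⟨i, j⟩ hc
  rw [YoungDiagram.mem_cells] at hc
  have h1 := YoungDiagram.mem_iff_lt_colLen.1 hc
  have h2 := YoungDiagram.mem_iff_lt_rowLen.1 hc
  have h3 := YoungDiagram.colLen_le_card μ j
  have h4 := YoungDiagram.rowLen_le_card μ i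
  have h5 : μ.card ≤ n := hμ
  simp only [Finset.mem_product, Finset.mem_range]
  omega

/-- The Young diagrams with `n` cells. -/
noncomputable def diagrams (n : ℕ) : Finset YoungDiagram :=
  ((YoungDiagram.finite_card_le n).subset
    (fun _ h => le_of_eq h : {μ : YoungDiagram | μ.card = n} ⊆ _)).toFinset

@[simp] lemma mem_diagrams {n : ℕ} {μ : YoungDiagram} : μ ∈ diagrams n ↔ μ.card = n := by
  simp [diagrams]

lemma YoungDiagram.colLen_eq_zero {μ : YoungDiagram} {j : ℕ} (h : μ.rowLen 0 ≤ j) :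
    μ.colLen j = 0 := by
  by_contra hc
  have h1 : (0, j) ∈ μ := YoungDiagram.mem_iff_lt_colLen.2 (Nat.pos_of_ne_zero hc)
  have h2 := YoungDiagram.mem_iff_lt_rowLen.1 h1
  omega

lemma YoungDiagram.ext_colLen {μ ν : YoungDiagram} (h : ∀ j, μ.colLen j = ν.colLen j) : μ = ν := by
  apply YoungDiagram.ext
  ext ⟨i, j⟩
  rw [YoungDiagram.mem_cells, YoungDiagram.mem_cells, YoungDiagram.mem_iff_lt_colLen,
    YoungDiagram.mem_iff_lt_colLen, h]

lemma YoungDiagram.card_eq_sum_colLen {μ : YoungDiagram} {T : ℕ} (h : μ.rowLen 0 ≤ T) :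
    μ.card = ∑ j ∈ Finset.range T, μ.colLen j := by
  rw [YoungDiagram.card, Finset.card_eq_sum_card_fiberwise (f := Prod.snd) (t := Finset.range T)]
  · refine Finset.sum_congr rfl fun j _ => ?_
    rw [YoungDiagram.colLen_eq_card]
    rfl
  · rintro ⟨i, j⟩ hc
    simp only [Finset.coe_range, Set.mem_Iio]
    rw [Finset.mem_coe, YoungDiagram.mem_cells] at hc
    have h1 := YoungDiagram.mem_iff_lt_rowLen.1 (μ.up_left_mem (Nat.zero_le i) le_rfl hc)
    omega

lemma YoungDiagram.exists_colLen_eq (b : ℕ → ℕ) (hb : Antitone b) (T : ℕ)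
    (hT : ∀ j, T ≤ j → b j = 0) : ∃ μ : YoungDiagram, ∀ j, μ.colLen j = b j := by
  have hmem : ∀ c : ℕ × ℕ, c ∈ (Finset.range (b 0) ×ˢ Finset.range T).filter
      (fun c => c.1 < b c.2) ↔ c.1 < b c.2 := by
    rintro ⟨i, j⟩
    simp only [Finset.mem_filter, Finset.mem_product, Finset.mem_range, and_iff_right_iff_imp]
    intro h
    have h1 := hb (Nat.zero_le j)
    refine ⟨by omega, ?_⟩
    by_contra hc
    rw [hT j (by omega)] at h
    omega
  refine ⟨⟨(Finset.range (b 0) ×ˢ Finset.range T).filter (fun c => c.1 < b c.2), ?_⟩, ?_⟩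
  · rintro ⟨i, j⟩ ⟨i', j'⟩ hle h
    rw [Finset.mem_coe, hmem] at h ⊢
    have h1 := hb hle.2
    have h2 : i' ≤ i := hle.1
    simp only at h h1 ⊢
    omega
  · intro j
    refine eq_of_forall_lt_iff fun i => ?_
    rw [← YoungDiagram.mem_iff_lt_colLen]
    exact hmem (i, j)

/-- `ν / μ` is a horizontal strip. -/
def IsHorizontalStrip (μ ν : YoungDiagram) : Prop :=
  μ ≤ ν ∧ ∀ i j, (i + 1, j) ∈ ν → (i, j) ∈ μ

lemma isHorizontalStrip_iff {μ ν : YoungDiagram} : IsHorizontalStrip μ ν ↔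
    ∀ j, μ.colLen j ≤ ν.colLen j ∧ ν.colLen j ≤ μ.colLen j + 1 := by
  constructor
  · rintro ⟨h1, h2⟩ j
    constructor
    · by_contra hc
      have h3 : (ν.colLen j, j) ∈ ν := h1 (YoungDiagram.mem_iff_lt_colLen.2 (not_le.1 hc))
      exact lt_irrefl _ (YoungDiagram.mem_iff_lt_colLen.1 h3)
    · by_contra hc
      have h3 := h2 (μ.colLen j) j (YoungDiagram.mem_iff_lt_colLen.2 (not_le.1 hc))
      exact lt_irrefl _ (YoungDiagram.mem_iff_lt_colLen.1 h3)
  · intro h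
    constructor
    · rintro ⟨i, j⟩ hc
      have h1 := YoungDiagram.mem_iff_lt_colLen.1 ((YoungDiagram.mem_cells _).1 hc)
      exact YoungDiagram.mem_iff_lt_colLen.2 (h1.trans_le (h j).1)
    · intro i j hc
      have h1 := YoungDiagram.mem_iff_lt_colLen.1 hc
      have h2 := (h j).2
      exact YoungDiagram.mem_iff_lt_colLen.2 (by omega)

section Determinants

variable {R : Type*} [CommRing R]

/-- The Jacobi–Trudi determinant of the column lengths of a diagram, of size `T`. -/
def columnDet (e : ℤ → R) (T : ℕ) (μ : YoungDiagram) : R :=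
  toeplitzDet e fun i : Fin T => (μ.colLen i : ℤ)

/-- Row i depends only on α i - i. This discards the terms of the Pieri sum that are not diagrams.
-/
lemma toeplitzDet_eq_zero (e : ℤ → R) {T : ℕ} (α : Fin T → ℤ) {i j : Fin T} (hij : i ≠ j)
    (h : α i - (i : ℕ) = α j - (j : ℕ)) : toeplitzDet e α = 0 := by
  refine Matrix.det_zero_of_row_eq hij ?_
  ext m
  simp only [Matrix.of_apply]
  congr 1
  linarith

/-- The last row is (0, …, 0, 1), so empty columns of a diagram may be appended freely. -/
lemma toeplitzDet_succ (e : ℤ → R) (h0 : e 0 = 1) (hneg : ∀ n < 0, e n = 0) (T : ℕ)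
    (α : ℕ → ℤ) (hα : α T = 0) :
    toeplitzDet e (fun i : Fin (T + 1) => α i) = toeplitzDet e (fun i : Fin T => α i) := by
  rw [toeplitzDet, Matrix.det_succ_row _ (Fin.last T), Finset.sum_eq_single (Fin.last T)]
  · simp only [Matrix.of_apply, Fin.val_last, hα, zero_add, sub_self, h0, mul_one]
    rw [← two_mul, pow_mul, neg_one_sq, one_pow, one_mul, toeplitzDet]
    congr 1
    ext i j
    simp
  · intro j _ hj
    have : (j : ℕ) < T := by
      have := j.2
      have h2 : (j : ℕ) ≠ T := fun h => hj (Fin.ext h)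
      omega
    simp only [Matrix.of_apply, Fin.val_last, hα]
    rw [hneg _ (by omega)]
    simp
  · intro h
    exact absurd (Finset.mem_univ _) h

lemma columnDet_eq (e : ℤ → R) (h0 : e 0 = 1) (hneg : ∀ n < 0, e n = 0) (T : ℕ)
    (μ : YoungDiagram) (hT : μ.rowLen 0 ≤ T) :
    columnDet e T μ = columnDet e (μ.rowLen 0) μ := by
  induction T, hT using Nat.le_induction with
  | base => rfl
  | succ T hT ih =>
    rw [← ih]
    exact toeplitzDet_succ e h0 hneg T (fun i => (μ.colLen i : ℤ))
      (by rw [YoungDiagram.colLen_eq_zero hT]; rfl)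

open Classical in
/-- The Pieri rule for Jacobi–Trudi determinants, for `h` vanishing above degree `T`. -/
theorem columnDet_mul_eq_sum (e : ℤ → R) (h : ℕ → R) (T : ℕ) (h0 : h 0 = 1)
    (he : ∀ n : ℤ, 0 < n →
      e n = ∑ m ∈ Finset.range T, (-1) ^ m * h (m + 1) * e (n - 1 - m))
    (μ : YoungDiagram) (k : ℕ) (hk : μ.card + k ≤ T) :
    columnDet e T μ * h k
      = ∑ ν ∈ diagrams (μ.card + k) with IsHorizontalStrip μ ν, columnDet e T ν := by
  rw [columnDet, toeplitzDet_mul_eq_sum e h T h0 he _ (fun _ => by positivity) k (by omega)]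
  symm
  have hrow : ∀ ν : YoungDiagram, ν.card = μ.card + k → ν.rowLen 0 ≤ T := fun ν hν =>
    (YoungDiagram.rowLen_le_card ν 0).trans (by omega)
  have hμT : μ.rowLen 0 ≤ T := (YoungDiagram.rowLen_le_card μ 0).trans (by omega)
  have hcol : ∀ ν : YoungDiagram, IsHorizontalStrip μ ν → ∀ j : ℕ,
      ν.colLen j = μ.colLen j + if μ.colLen j < ν.colLen j then 1 else 0 := by
    intro ν hν j
    have := isHorizontalStrip_iff.1 hν j
    split_ifs <;> omega
  -- A horizontal strip is recorded by the set of columns that grow, each by one cell.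
  refine Finset.sum_of_injOn
    (fun ν => Finset.univ.filter fun j : Fin T => μ.colLen j < ν.colLen j) ?_ ?_ ?_ ?_
  · intro ν hν ν' hν' heq
    simp only [Finset.coe_filter, mem_diagrams, Set.mem_ofPred_eq] at hν hν'
    apply YoungDiagram.ext_colLen
    intro j
    by_cases hj : j < T
    · have h1 := congrArg (fun S => (⟨j, hj⟩ : Fin T) ∈ S) heq
      simp only [Finset.mem_filter, Finset.mem_univ, true_and] at h1
      rw [hcol ν hν.2, hcol ν' hν'.2]
      simp only [h1]
    · rw [YoungDiagram.colLen_eq_zero ((hrow ν hν.1).trans (by omega)),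
        YoungDiagram.colLen_eq_zero ((hrow ν' hν'.1).trans (by omega))]
  · intro ν hν
    simp only [Finset.coe_filter, mem_diagrams, Set.mem_ofPred_eq] at hν
    rw [Finset.mem_coe, Finset.mem_powersetCard]
    refine ⟨Finset.subset_univ _, ?_⟩
    have h1 := YoungDiagram.card_eq_sum_colLen (hrow ν hν.1)
    have h2 := YoungDiagram.card_eq_sum_colLen hμT
    rw [Finset.sum_congr rfl fun j _ => hcol ν hν.2 j, Finset.sum_add_distrib, ← h2, hν.1,
      Finset.sum_range] at h1
    rw [Finset.card_filter]
    omega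
  · intro S hS hSim
    rw [Finset.mem_powersetCard] at hS
    set b : ℕ → ℕ := fun j => μ.colLen j + if ∃ h : j < T, (⟨j, h⟩ : Fin T) ∈ S then 1 else 0
      with hb
    have hbS : ∀ j : Fin T, b j = μ.colLen j + if j ∈ S then 1 else 0 := by
      intro j
      simp [hb]
    -- If b is antitone, it is the column lengths of a diagram. Otherwise two neighbouring columns
    -- of μ have equal length and only the right one grows, which makes the corresponding two rows
    -- equal.
    by_cases hanti : Antitone b
    · exfalso
      apply hSim
      have hbT : ∀ j, T ≤ j → b j = 0 := by
        intro j hj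
        simp only [hb]
        rw [YoungDiagram.colLen_eq_zero (hμT.trans hj), if_neg]
        rintro ⟨h, -⟩
        omega
      obtain ⟨ν, hν⟩ := YoungDiagram.exists_colLen_eq b hanti T hbT
      have hνT : ν.rowLen 0 ≤ T := by
        by_contra hc
        have h1 := YoungDiagram.mem_iff_lt_colLen.1
          (YoungDiagram.mem_iff_lt_rowLen.2 (not_le.1 hc))
        rw [hν, hbT T le_rfl] at h1
        omega
      refine ⟨ν, ?_, ?_⟩
      · simp only [Finset.coe_filter, mem_diagrams, Set.mem_ofPred_eq]
        constructor
        · rw [YoungDiagram.card_eq_sum_colLen hνT, YoungDiagram.card_eq_sum_colLen hμT,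
            Finset.sum_range, Finset.sum_range]
          simp only [hν, hbS, Finset.sum_add_distrib]
          rw [← hS.2, Finset.card_eq_sum_ones, ← Finset.sum_filter]
          simp
        · rw [isHorizontalStrip_iff]
          intro j
          rw [hν]
          simp only [hb]
          split_ifs <;> omega
      · ext j
        simp only [Finset.mem_filter, Finset.mem_univ, true_and, hν, hbS]
        split_ifs with hj <;> simp [hj]
    · have : ∃ j, b j < b (j + 1) := by
        by_contra hc
        push Not at hc
        exact hanti (antitone_nat_of_succ_le hc)
      obtain ⟨j, hj⟩ := this
      have h1 := μ.colLen_anti j (j + 1) (by omega)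
      have hj1 : j + 1 < T := by
        by_contra hc
        simp only [hb] at hj
        rw [if_neg (c := ∃ h : j + 1 < T, _) (by rintro ⟨h, -⟩; omega)] at hj
        omega
      have h2 := hbS ⟨j, by omega⟩
      have h3 := hbS ⟨j + 1, hj1⟩
      refine toeplitzDet_eq_zero e _ (i := ⟨j, by omega⟩) (j := ⟨j + 1, hj1⟩) (by simp) ?_
      simp only at h2 h3 ⊢
      split_ifs at h2 h3 ⊢ <;> push_cast <;> omega
  · intro ν hν
    simp only [mem_diagrams, Finset.mem_filter] at hν
    rw [columnDet]
    congr 1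
    ext j
    rw [hcol ν hν.2 j]
    simp

end Determinants
end NCSchur

/-! ### Semistandard tableaux and the branching rule -/

namespace NCSchur

section Tableaux

variable {μ ν : YoungDiagram}

/-- The content of a tableau. -/
noncomputable def content (T : SemistandardYoungTableau μ) : ℕ →₀ ℕ :=
  ∑ c ∈ μ.cells, Finsupp.single (T c.1 c.2) 1

lemma content_apply (T : SemistandardYoungTableau μ) (j : ℕ) :
    content T j = (μ.cells.filter fun c => T c.1 c.2 = j).card := by
  rw [content, Finsupp.finsetSum_apply, Finset.card_filter]
  refine Finset.sum_congr rfl fun c _ => ?_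
  rw [Finsupp.single_apply]

lemma content_apply_ne_zero (T : SemistandardYoungTableau μ) {i j : ℕ} (h : (i, j) ∈ μ) :
    content T (T i j) ≠ 0 := by
  rw [content_apply, Finset.card_ne_zero]
  exact ⟨(i, j), by simp [h]⟩

lemma degree_content (T : SemistandardYoungTableau μ) : (content T).degree = μ.card := by
  rw [content, map_sum]
  simp [Finsupp.degree_single]

/-- Every entry lies in the support of d, hence is bounded. Finiteness makes `Nat.card` a genuine
count. -/
lemma finite_content_eq (μ : YoungDiagram) (d : ℕ →₀ ℕ) :
    Finite {T : SemistandardYoungTableau μ // content T = d} := by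
  obtain ⟨M, hM⟩ := exists_forall_ge_eq_zero d
  have hlt : ∀ T : {T : SemistandardYoungTableau μ // content T = d}, ∀ c : μ.cells,
      T.1 c.1.1 c.1.2 < M := by
    intro T c
    by_contra hc
    refine content_apply_ne_zero T.1 ((YoungDiagram.mem_cells _).1 c.2) ?_
    rw [T.2]
    exact hM _ (not_lt.1 hc)
  refine Finite.of_injective
    (fun T (c : μ.cells) => (⟨T.1 c.1.1 c.1.2, hlt T c⟩ : Fin M)) ?_
  intro T T' h
  apply Subtype.ext
  ext i j
  by_cases hc : (i, j) ∈ μ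
  · have := congrFun h ⟨(i, j), (YoungDiagram.mem_cells _).2 hc⟩
    simpa using this
  · rw [T.1.zeros hc, T'.1.zeros hc]

/-- The number of tableaux of given shape and content. -/
noncomputable def kostka (μ : YoungDiagram) (d : ℕ →₀ ℕ) : ℕ :=
  Nat.card {T : SemistandardYoungTableau μ // content T = d}

lemma kostka_eq_zero {d : ℕ →₀ ℕ} (h : μ.card ≠ d.degree) : kostka μ d = 0 := by
  have : IsEmpty {T : SemistandardYoungTableau μ // content T = d} :=
    ⟨fun T => h (by rw [← degree_content T.1, T.2])⟩
  exact Nat.card_of_isEmpty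

/-- The shape formed by the cells with entry less than `n`. -/
def subshape (n : ℕ) (T : SemistandardYoungTableau ν) : YoungDiagram where
  cells := ν.cells.filter fun c => T c.1 c.2 < n
  isLowerSet := by
    rintro ⟨i, j⟩ ⟨i', j'⟩ hle h
    simp only [Finset.coe_filter, YoungDiagram.mem_cells, Set.mem_ofPred_eq] at h ⊢
    have h1 : (i, j') ∈ ν := ν.up_left_mem le_rfl hle.2 h.1
    refine ⟨ν.up_left_mem hle.1 hle.2 h.1, ?_⟩
    exact ((T.col_weak hle.1 h1).trans (T.row_weak_of_le hle.2 h.1)).trans_lt h.2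

lemma mem_subshape {n : ℕ} {T : SemistandardYoungTableau ν} {i j : ℕ} :
    (i, j) ∈ subshape n T ↔ (i, j) ∈ ν ∧ T i j < n := by
  rw [← YoungDiagram.mem_cells, subshape]
  simp

/-- The restriction of a tableau to a subshape. -/
def restrictTableau (h : μ ≤ ν) (T : SemistandardYoungTableau ν) : SemistandardYoungTableau μ where
  entry i j := if (i, j) ∈ μ then T i j else 0
  row_weak' {i j₁ j₂} hj hc := by
    rw [if_pos hc, if_pos (μ.up_left_mem le_rfl hj.le hc)]
    exact T.row_weak hj (h hc)
  col_strict' {i₁ i₂ j} hi hc := by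
    rw [if_pos hc, if_pos (μ.up_left_mem hi.le le_rfl hc)]
    exact T.col_strict hi (h hc)
  zeros' hc := if_neg hc

lemma restrictTableau_apply (h : μ ≤ ν) (T : SemistandardYoungTableau ν) (i j : ℕ) :
    restrictTableau h T i j = if (i, j) ∈ μ then T i j else 0 := rfl

/-- The extension of a tableau by the entry `n` on a horizontal strip. -/
def extendTableau (h : IsHorizontalStrip μ ν) (n : ℕ) (T : SemistandardYoungTableau μ)
    (hT : ∀ i j, (i, j) ∈ μ → T i j < n) : SemistandardYoungTableau ν where
  entry i j := if (i, j) ∈ μ then T i j else if (i, j) ∈ ν then n else 0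
  row_weak' {i j₁ j₂} hj hc := by
    by_cases h2 : (i, j₂) ∈ μ
    · rw [if_pos h2, if_pos (μ.up_left_mem le_rfl hj.le h2)]
      exact T.row_weak hj h2
    · rw [if_neg h2, if_pos hc]
      split_ifs with h3 h4
      · exact (hT _ _ h3).le
      · exact le_rfl
      · exact Nat.zero_le _
  col_strict' {i₁ i₂ j} hi hc := by
    -- In a horizontal strip, a cell with another cell of ν below it belongs to μ.
    have h1 : (i₁, j) ∈ μ := by
      obtain ⟨i, rfl⟩ : ∃ i, i₂ = i + 1 := ⟨i₂ - 1, by omega⟩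
      exact μ.up_left_mem (by omega) le_rfl (h.2 i j hc)
    rw [if_pos h1]
    split_ifs with h2
    · exact T.col_strict hi h2
    · exact hT _ _ h1
  zeros' hc := by rw [if_neg (fun h' => hc (h.1 h')), if_neg hc]

lemma extendTableau_apply (h : IsHorizontalStrip μ ν) (n : ℕ) (T : SemistandardYoungTableau μ)
    (hT : ∀ i j, (i, j) ∈ μ → T i j < n) (i j : ℕ) :
    extendTableau h n T hT i j = if (i, j) ∈ μ then T i j else if (i, j) ∈ ν then n else 0 := rfl

lemma content_eq_add_single (h : μ ≤ ν) (T : SemistandardYoungTableau ν)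
    (T' : SemistandardYoungTableau μ) (n : ℕ) (h1 : ∀ i j, (i, j) ∈ μ → T i j = T' i j)
    (h2 : ∀ i j, (i, j) ∈ ν → (i, j) ∉ μ → T i j = n) :
    content T = content T' + Finsupp.single n (ν.card - μ.card) := by
  have hsub : μ.cells ⊆ ν.cells := h
  rw [content, ← Finset.sum_sdiff hsub, add_comm, content]
  congr 1
  · refine Finset.sum_congr rfl fun c hc => ?_
    rw [h1 _ _ ((YoungDiagram.mem_cells _).1 hc)]
  · rw [Finset.sum_congr rfl (g := fun _ => Finsupp.single n 1), Finset.sum_const,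
      Finset.card_sdiff_of_subset hsub, Finsupp.smul_single]
    · simp
    · intro c hc
      simp only [Finset.mem_sdiff, YoungDiagram.mem_cells] at hc
      rw [h2 _ _ hc.1 hc.2]

variable {n : ℕ} {d : ℕ →₀ ℕ}

lemma entry_le_of_content (hd : ∀ j, n + 1 ≤ j → d j = 0) {T : SemistandardYoungTableau ν}
    (hT : content T = d) {i j : ℕ} (h : (i, j) ∈ ν) : T i j ≤ n := by
  by_contra hc
  refine content_apply_ne_zero T h ?_
  rw [hT]
  exact hd _ (by omega)

lemma entry_lt_of_content_erase (hd : ∀ j, n + 1 ≤ j → d j = 0) {T : SemistandardYoungTableau μ}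
    (hT : content T = d.erase n) {i j : ℕ} (h : (i, j) ∈ μ) : T i j < n := by
  by_contra hc
  refine content_apply_ne_zero T h ?_
  rw [hT]
  by_cases hn : T i j = n
  · rw [hn, Finsupp.erase_same]
  · rw [Finsupp.erase_ne hn]
    exact hd _ (by omega)

/-- The largest possible entry is n and columns increase strictly, so anything above another cell is
less than n. -/
lemma isHorizontalStrip_subshape (hd : ∀ j, n + 1 ≤ j → d j = 0) {T : SemistandardYoungTableau ν}
    (hT : content T = d) : IsHorizontalStrip (subshape n T) ν := by
  constructor
  · rintro ⟨i, j⟩ hc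
    exact (mem_subshape.1 hc).1
  · intro i j hc
    rw [mem_subshape]
    refine ⟨ν.up_left_mem (Nat.le_succ i) le_rfl hc, ?_⟩
    exact (T.col_strict (Nat.lt_succ_self i) hc).trans_le (entry_le_of_content hd hT hc)

lemma card_subshape (hd : ∀ j, n + 1 ≤ j → d j = 0) {T : SemistandardYoungTableau ν}
    (hT : content T = d) : (subshape n T).card + d n = ν.card := by
  rw [YoungDiagram.card, YoungDiagram.card, ← Finset.card_filter_add_card_filter_not
    (s := ν.cells) (fun c => T c.1 c.2 < n), ← hT, content_apply]
  congr 2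
  refine Finset.filter_congr fun c hc => ?_
  have := entry_le_of_content hd hT ((YoungDiagram.mem_cells _).1 hc)
  omega

/-- Removing the entries `n` from the tableaux whose smaller entries form the shape `μ`. -/
def subshapeEquiv (hd : ∀ j, n + 1 ≤ j → d j = 0) (h : IsHorizontalStrip μ ν)
    (hcard : μ.card + d n = ν.card) :
    {T : SemistandardYoungTableau ν // content T = d ∧ subshape n T = μ} ≃
      {T : SemistandardYoungTableau μ // content T = d.erase n} where
  toFun T := ⟨restrictTableau h.1 T.1, by
    obtain ⟨T, hT, rfl⟩ := T
    have h1 := content_eq_add_single h.1 T (restrictTableau h.1 T) n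
      (fun i j hc => by rw [restrictTableau_apply, if_pos hc])
      (fun i j hc hc' => by
        have := entry_le_of_content hd hT hc
        rw [mem_subshape, not_and] at hc'
        have := hc' hc
        omega)
    rw [hT, show ν.card - (subshape n T).card = d n by omega] at h1
    nth_rewrite 1 [← Finsupp.erase_add_single n d] at h1
    exact (add_right_cancel h1).symm⟩
  invFun T := ⟨extendTableau h n T.1 fun i j hc => entry_lt_of_content_erase hd T.2 hc, by
    constructor
    · rw [content_eq_add_single h.1 _ T.1 n
        (fun i j hc => by rw [extendTableau_apply, if_pos hc])
        (fun i j hc hc' => by rw [extendTableau_apply, if_neg hc', if_pos hc]), T.2,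
        show ν.card - μ.card = d n by omega, Finsupp.erase_add_single]
    · apply YoungDiagram.ext
      ext ⟨i, j⟩
      rw [YoungDiagram.mem_cells, YoungDiagram.mem_cells, mem_subshape, extendTableau_apply]
      constructor
      · rintro ⟨hc, hlt⟩
        by_contra hc'
        rw [if_neg hc', if_pos hc] at hlt
        exact lt_irrefl _ hlt
      · intro hc
        refine ⟨h.1 hc, ?_⟩
        rw [if_pos hc]
        exact entry_lt_of_content_erase hd T.2 hc⟩
  left_inv := by
    rintro ⟨T, hT, rfl⟩
    apply Subtype.ext
    ext i j
    simp only [extendTableau_apply, restrictTableau_apply]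
    split_ifs with h1 h2
    · rfl
    · have := entry_le_of_content hd hT h2
      rw [mem_subshape, not_and] at h1
      have := h1 h2
      omega
    · exact (T.zeros h2).symm
  right_inv := by
    rintro ⟨T, hT⟩
    apply Subtype.ext
    ext i j
    simp only [extendTableau_apply, restrictTableau_apply]
    split_ifs with h1
    · rfl
    · exact (T.zeros h1).symm

open Classical in
/-- The branching rule for the numbers of tableaux. -/
theorem kostka_eq_sum (hd : ∀ j, n + 1 ≤ j → d j = 0) {m : ℕ} (hν : ν.card = m + d n) :
    kostka ν d = ∑ μ ∈ diagrams m with IsHorizontalStrip μ ν, kostka μ (d.erase n) := by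
  have hfin : {T : SemistandardYoungTableau ν | content T = d}.Finite := finite_content_eq ν d
  have h1 : kostka ν d = hfin.toFinset.card := Nat.subtype_card _ (by simp)
  -- Tableaux are sorted by the shape of their entries below n; `subshapeEquiv` counts each fibre.
  rw [h1, Finset.card_eq_sum_card_fiberwise (f := subshape n)
    (t := (diagrams m).filter fun μ => IsHorizontalStrip μ ν)]
  · refine Finset.sum_congr rfl fun μ hμ => ?_
    rw [Finset.mem_filter, mem_diagrams] at hμ
    rw [kostka, ← Nat.card_congr (subshapeEquiv hd hμ.2 (by omega))]
    symm
    exact Nat.subtype_card _ (by simp)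
  · intro T hT
    have hT' : content T = d := by simpa using hT
    rw [Finset.mem_coe, Finset.mem_filter, mem_diagrams]
    have := card_subshape hd hT'
    exact ⟨by omega, isHorizontalStrip_subshape hd hT'⟩

end Tableaux
end NCSchur

/-! ### Expansion of products of h_k with Kostka numbers -/

namespace NCSchur

section KostkaExpansion

variable {R : Type*} [CommRing R]

lemma diagrams_zero : diagrams 0 = {⊥} := by
  ext μ
  rw [mem_diagrams, Finset.mem_singleton, YoungDiagram.card, Finset.card_eq_zero]
  exact ⟨fun h => YoungDiagram.ext h, fun h => by rw [h]; rfl⟩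

lemma kostka_bot_zero : kostka ⊥ 0 = 1 := by
  rw [kostka, Nat.card_eq_one_iff_unique]
  refine ⟨⟨?_⟩, ⟨⟨default, ?_⟩⟩⟩
  · rintro ⟨T, -⟩ ⟨T', -⟩
    apply Subtype.ext
    ext i j
    rw [T.zeros (YoungDiagram.notMem_bot _), T'.zeros (YoungDiagram.notMem_bot _)]
  · simp [content]

/-- The expansion of products of the `h_k` for a sequence `e` whose recursion has length `T`. -/
theorem prod_eq_sum_kostka_of_recursion (e : ℤ → R) (h : ℕ → R) (T : ℕ) (h0 : h 0 = 1)
    (e0 : e 0 = 1) (hneg : ∀ n < 0, e n = 0)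
    (he : ∀ n : ℤ, 0 < n →
      e n = ∑ m ∈ Finset.range T, (-1) ^ m * h (m + 1) * e (n - 1 - m))
    (n : ℕ) (d : ℕ →₀ ℕ) (hd : ∀ j, n ≤ j → d j = 0) (hT : d.degree ≤ T) :
    ∏ j ∈ Finset.range n, h (d j)
      = ∑ μ ∈ diagrams d.degree, (kostka μ d : R) * columnDet e T μ := by
  classical
  induction n generalizing d with
  | zero =>
    have : d = 0 := by ext j; exact hd j (by omega)
    subst this
    have h1 : (⊥ : YoungDiagram).rowLen 0 = 0 := by
      by_contra hc
      exact YoungDiagram.notMem_bot _ (YoungDiagram.mem_iff_lt_rowLen.2 (Nat.pos_of_ne_zero hc))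
    have h2 : columnDet e T ⊥ = 1 := by
      rw [columnDet_eq e e0 hneg T ⊥ (by omega), columnDet, toeplitzDet, Matrix.det_eq_one_of_card_eq_zero]
      simp [h1]
    simp [diagrams_zero, kostka_bot_zero, h2]
  | succ n ih =>
    have hdeg : (d.erase n).degree + d n = d.degree := by
      conv_rhs => rw [← Finsupp.erase_add_single n d]
      rw [map_add, Finsupp.degree_single]
    have h1 := ih (d.erase n) (fun j hj => by
      by_cases hjn : j = n
      · rw [hjn, Finsupp.erase_same]
      · rw [Finsupp.erase_ne hjn, hd j (by omega)]) (by omega)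
    rw [Finset.prod_range_succ, ← Finset.prod_congr rfl (g := fun j => h (d j))
      (f := fun j => h (d.erase n j)) fun j hj => ?_, h1, Finset.sum_mul]
    -- Multiplying by the last factor h (d n) adds strips by Pieri; after exchanging the sums,
    -- branching collects them into the Kostka numbers of d.
    · have h2 : ∀ μ ∈ diagrams (d.erase n).degree,
          (kostka μ (d.erase n) : R) * columnDet e T μ * h (d n)
          = ∑ ν ∈ diagrams d.degree, if IsHorizontalStrip μ ν then
              (kostka μ (d.erase n) : R) * columnDet e T ν else 0 := by
        intro μ hμ
        rw [mem_diagrams] at hμ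
        rw [mul_assoc, columnDet_mul_eq_sum e h T h0 he μ (d n) (by omega), hμ, hdeg,
          Finset.mul_sum, Finset.sum_filter]
      rw [Finset.sum_congr rfl h2, Finset.sum_comm]
      refine Finset.sum_congr rfl fun ν hν => ?_
      rw [mem_diagrams] at hν
      rw [kostka_eq_sum hd (hν.trans hdeg.symm), Nat.cast_sum, Finset.sum_mul, Finset.sum_filter]
    · rw [Finset.mem_range] at hj
      rw [Finsupp.erase_ne (by omega)]

/-- The sequence with the linear recursion whose coefficients are `(-1)^m h_{m+1}` for `m < T`. -/
def recursionSeq (h : ℕ → R) (T : ℕ) : ℕ → R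
  | 0 => 1
  | n + 1 => ∑ m : Fin T, if (m : ℕ) ≤ n then (-1) ^ (m : ℕ) * h (m + 1) * recursionSeq h T (n - m)
      else 0

/-- The Pieri argument needs a recursion of bounded length T, whereas the relation between e and h
has unbounded length. The truncated sequence serves as a substitute in degrees up to T. -/
lemma exists_recursion (h : ℕ → R) (T : ℕ) : ∃ e : ℤ → R, e 0 = 1 ∧ (∀ n < 0, e n = 0) ∧
    ∀ n : ℤ, 0 < n → e n = ∑ m ∈ Finset.range T, (-1) ^ m * h (m + 1) * e (n - 1 - m) := by
  refine ⟨fun n => if n < 0 then 0 else recursionSeq h T n.toNat, ?_, ?_, ?_⟩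
  · simp [recursionSeq]
  · intro n hn
    exact if_pos hn
  · intro n hn
    obtain ⟨n, rfl⟩ : ∃ k : ℕ, n = (k + 1 : ℕ) := ⟨(n - 1).toNat, by omega⟩
    dsimp only
    rw [if_neg (by omega), Int.toNat_natCast, recursionSeq, Finset.sum_range]
    refine Finset.sum_congr rfl fun m _ => ?_
    by_cases hm : (m : ℕ) ≤ n
    · rw [if_pos hm, if_neg (by omega)]
      congr 2
      omega
    · rw [if_neg hm, if_pos (by omega), mul_zero]

/-- In each term of the determinant the indices sum to ∑ α. Either one is negative and the term
vanishes, or all are at most ∑ α. -/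
lemma toeplitzDet_congr {e e' : ℤ → R} (hneg : ∀ n < 0, e n = 0) (hneg' : ∀ n < 0, e' n = 0)
    {T : ℕ} (α : Fin T → ℤ) (h : ∀ n ≤ ∑ i, α i, e n = e' n) :
    toeplitzDet e α = toeplitzDet e' α := by
  rw [toeplitzDet, toeplitzDet, Matrix.det_apply, Matrix.det_apply]
  refine Finset.sum_congr rfl fun σ _ => ?_
  congr 1
  simp only [Matrix.of_apply]
  by_cases hσ : ∀ i, 0 ≤ α (σ i) + ((i : ℕ) : ℤ) - ((σ i : ℕ) : ℤ)
  · refine Finset.prod_congr rfl fun i _ => h _ ?_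
    refine (Finset.single_le_sum (f := fun i => α (σ i) + ((i : ℕ) : ℤ) - ((σ i : ℕ) : ℤ))
      (fun i _ => hσ i) (Finset.mem_univ i)).trans (le_of_eq ?_)
    rw [Finset.sum_sub_distrib, Finset.sum_add_distrib, Equiv.sum_comp σ α,
      Equiv.sum_comp σ (fun i => ((i : ℕ) : ℤ))]
    ring
  · push Not at hσ
    obtain ⟨i, hi⟩ := hσ
    rw [Finset.prod_eq_zero (Finset.mem_univ i) (hneg _ hi),
      Finset.prod_eq_zero (Finset.mem_univ i) (hneg' _ hi)]

/-- The expansion of products of complete homogeneous elements in Jacobi–Trudi determinants. -/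
theorem prod_eq_sum_kostka (e : ℤ → R) (h : ℕ → R) (h0 : h 0 = 1)
    (e0 : e 0 = 1) (hneg : ∀ n < 0, e n = 0)
    (heh : ∀ k : ℕ, k ≠ 0 → ∑ m ∈ Finset.range (k + 1), (-1) ^ m * (e m * h (k - m)) = 0)
    (n : ℕ) (d : ℕ →₀ ℕ) (hd : ∀ j, n ≤ j → d j = 0) :
    ∏ j ∈ Finset.range n, h (d j)
      = ∑ μ ∈ diagrams d.degree, (kostka μ d : R) * columnDet e (μ.rowLen 0) μ := by
  obtain ⟨e', e0', hneg', he'⟩ := exists_recursion h d.degree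
  set T := d.degree with hTdef
  -- For n ≤ T the truncation drops only terms of negative index, so both recursions coincide.
  have hagree : ∀ n : ℕ, n ≤ T → e n = e' n := by
    intro n
    induction n using Nat.strong_induction_on with
    | _ n ih =>
      intro hn
      by_cases hn0 : n = 0
      · subst hn0
        simp [e0, e0']
      · have h1 := heh n hn0
        rw [← Finset.sum_range_reflect, Finset.sum_range_succ'] at h1
        simp only [Nat.add_sub_cancel, Nat.sub_zero, Nat.sub_self, h0, mul_one] at h1
        have h2 : ∀ m ∈ Finset.range n, (-1 : R) ^ (n - (m + 1)) * (e ((n - (m + 1) : ℕ) : ℤ) *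
            h (n - (n - (m + 1)))) =
            - (-1) ^ n * ((-1) ^ m * h (m + 1) * e' ((n : ℤ) - 1 - m)) := by
          intro m hm
          rw [Finset.mem_range] at hm
          have h3 : n - (n - (m + 1)) = m + 1 := by omega
          have h4 : ((n - (m + 1) : ℕ) : ℤ) = (n : ℤ) - 1 - m := by omega
          rw [ih _ (by omega) (by omega), h3, h4]
          have h5 : (-1 : R) ^ n = (-1) ^ (n - (m + 1)) * (-1) ^ m * (-1) := by
            rw [← pow_add, ← pow_succ]
            congr 1
            omega
          have h6 : (-1 : R) ^ m * (-1) ^ m = 1 := by rw [← mul_pow]; simp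
          rw [h5]
          linear_combination (-(-1) ^ (n - (m + 1)) * e' ((n : ℤ) - 1 - m) * h (m + 1)) * h6
        rw [Finset.sum_congr rfl h2, ← Finset.mul_sum] at h1
        have h7 : (-1 : R) ^ n * (-1) ^ n = 1 := by rw [← mul_pow]; simp
        rw [he' n (by omega), ← Finset.sum_subset (Finset.range_subset_range.2 hn)]
        · linear_combination (-1 : R) ^ n * h1 - (e n - ∑ m ∈ Finset.range n,
            (-1) ^ m * h (m + 1) * e' ((n : ℤ) - 1 - m)) * h7
        · intro m hm hm'
          rw [Finset.mem_range] at hm hm'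
          rw [hneg' _ (by omega), mul_zero]
  rw [prod_eq_sum_kostka_of_recursion e' h T h0 e0' hneg' he' n d hd le_rfl]
  refine Finset.sum_congr rfl fun μ hμ => ?_
  rw [mem_diagrams] at hμ
  have hrow : μ.rowLen 0 ≤ T := (YoungDiagram.rowLen_le_card μ 0).trans hμ.le
  rw [← columnDet_eq e e0 hneg T μ hrow]
  congr 1
  refine toeplitzDet_congr hneg' hneg _ fun k hk => ?_
  have hsum : ∑ i : Fin T, (μ.colLen i : ℤ) = T := by
    have h1 := (YoungDiagram.card_eq_sum_colLen hrow).symm.trans hμ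
    rw [Finset.sum_range] at h1
    exact_mod_cast h1
  rw [hsum] at hk
  by_cases hk0 : k < 0
  · rw [hneg _ hk0, hneg' _ hk0]
  · obtain ⟨k, rfl⟩ := Int.eq_ofNat_of_zero_le (not_lt.1 hk0)
    exact (hagree k (by omega)).symm

end KostkaExpansion
end NCSchur

/-! ### Pairing, passage to the quotient by I_C, and the theorem -/

namespace NCSchur

variable {N : ℕ}

/-- The pairing with a fixed element of the dual, as an additive homomorphism. -/
noncomputable def pairingHom (γ : UDual N) : U N →+ ℤ where
  toFun z := pairing z γ
  map_zero' := by
    simp [pairing, ← coeffWordHom_apply]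
  map_add' z z' := by
    simp [pairing, ← coeffWordHom_apply, mul_add, Finsupp.sum, Finset.sum_add_distrib]

lemma pairingHom_apply (γ : UDual N) (z : U N) : pairingHom γ z = pairing z γ := rfl

lemma elem_natCast (k : ℕ) : elem N (k : ℤ) = elemNat N k := by
  rw [elem, if_neg (by omega), Int.toNat_natCast]

lemma elem_of_neg {k : ℤ} (hk : k < 0) : elem N k = 0 := if_pos hk

section Homogeneity

/-- All words occurring in `z` have length `k`. -/
def IsHomogeneousOfDegree (z : U N) (k : ℤ) : Prop :=
  ∀ w, coeffWord w z ≠ 0 → (w.toList.length : ℤ) = k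

lemma isHomogeneousOfDegree_elem (k : ℤ) : IsHomogeneousOfDegree (elem N k) k := by
  intro w hw
  by_cases hk : k < 0
  · rw [elem_of_neg hk, ← coeffWordHom_apply, map_zero] at hw
    exact absurd rfl hw
  · obtain ⟨k, rfl⟩ := Int.eq_ofNat_of_zero_le (not_lt.1 hk)
    rw [elem_natCast, coeffWord_elemNat] at hw
    by_contra hc
    exact hw (if_neg fun h => hc (congrArg _ h.1))

lemma IsHomogeneousOfDegree.mul {z z' : U N} {k k' : ℤ} (hz : IsHomogeneousOfDegree z k)
    (hz' : IsHomogeneousOfDegree z' k') : IsHomogeneousOfDegree (z * z') (k + k') := by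
  intro w hw
  rw [coeffWord_mul] at hw
  obtain ⟨m, hm, h⟩ := Finset.exists_ne_zero_of_sum_ne_zero hw
  rw [Finset.mem_range] at hm
  have h1 := hz _ (left_ne_zero_of_mul h)
  have h2 := hz' _ (right_ne_zero_of_mul h)
  rw [FreeMonoid.toList_ofList, List.length_take] at h1
  rw [FreeMonoid.toList_ofList, List.length_drop] at h2
  omega

lemma isHomogeneousOfDegree_one : IsHomogeneousOfDegree (1 : U N) 0 := by
  have := isHomogeneousOfDegree_elem (N := N) ((0 : ℕ) : ℤ)
  rwa [elem_natCast, elemNat_zero] at this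

lemma isHomogeneousOfDegree_prod_ofFn {t : ℕ} (z : Fin t → U N) (k : Fin t → ℤ)
    (h : ∀ i, IsHomogeneousOfDegree (z i) (k i)) :
    IsHomogeneousOfDegree (List.ofFn z).prod (∑ i, k i) := by
  induction t with
  | zero => simpa using isHomogeneousOfDegree_one
  | succ t ih =>
    rw [List.ofFn_succ, List.prod_cons, Fin.sum_univ_succ]
    exact (h 0).mul (ih _ _ fun i => h i.succ)

lemma isHomogeneousOfDegree_ncSchur (μ : YoungDiagram) :
    IsHomogeneousOfDegree (ncSchur N μ) μ.card := by
  intro w hw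
  rw [ncSchur, ← coeffWordHom_apply, map_sum] at hw
  obtain ⟨π, -, h⟩ := Finset.exists_ne_zero_of_sum_ne_zero hw
  rw [map_zsmul] at h
  have h1 := isHomogeneousOfDegree_prod_ofFn _ _ (fun i : Fin (μ.rowLen 0) =>
    isHomogeneousOfDegree_elem (N := N) ((μ.colLen i : ℤ) + ((π i : ℕ) : ℤ) - ((i : ℕ) : ℤ)))
    w (right_ne_zero_of_smul h)
  rw [h1, Finset.sum_sub_distrib, Finset.sum_add_distrib,
    Equiv.sum_comp π (fun i => ((i : ℕ) : ℤ)), YoungDiagram.card_eq_sum_colLen le_rfl,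
    Finset.sum_range, Nat.cast_sum]
  ring

/-- Each 𝔍_λ is homogeneous of degree |λ|, and the words of γ have bounded length. -/
lemma finite_pairing_ncSchur (γ : UDual N) :
    {μ : YoungDiagram | pairing (ncSchur N μ) γ ≠ 0}.Finite := by
  refine (YoungDiagram.finite_card_le (γ.support.sup fun w => w.toList.length)).subset ?_
  intro μ hμ
  obtain ⟨w, hw, h⟩ := Finset.exists_ne_zero_of_sum_ne_zero hμ
  have h1 := isHomogeneousOfDegree_ncSchur μ w (right_ne_zero_of_mul h)
  have h2 := Finset.le_sup (f := fun w : FreeMonoid (Fin N) => w.toList.length) hw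
  have h3 : μ.card ≤ γ.support.sup fun w => w.toList.length := by
    omega
  exact h3

end Homogeneity

section Quotient

lemma mk_eq_zero_iff (I : TwoSidedIdeal (U N)) (z : U N) : I.ringCon.mk' z = 0 ↔ z ∈ I := by
  rw [← TwoSidedIdeal.mem_ker, TwoSidedIdeal.ker_ringCon_mk']

lemma mk_relations (z : U N) (hz : z ∈ relations N) : (idealC N).ringCon.mk' z = 0 :=
  (mk_eq_zero_iff _ _).2 (TwoSidedIdeal.subset_span hz)

lemma homog_comm_mem (k l : ℕ) : homog N k * homog N l - homog N l * homog N k ∈ idealC N := by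
  obtain ⟨C, _, φ, h, e, hh, -⟩ := exists_commRing_lift _ (mk_relations (N := N))
  rw [← mk_eq_zero_iff, map_sub, map_mul, map_mul, ← hh, ← hh, ← map_mul, ← map_mul, mul_comm,
    sub_self]

lemma coeff_seriesH_mul_seriesH {i j : Fin 2} (hij : i ≠ j) (d : Fin 2 →₀ ℕ) :
    MvPowerSeries.coeff d (seriesH N i * seriesH N j) = homog N (d i) * homog N (d j) := by
  rw [coeff_mul_seriesH, coeff_seriesH, if_pos, Finsupp.erase_ne hij]
  · intro m hm
    rw [Finsupp.support_erase, Finset.mem_erase] at hm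
    rw [Finset.mem_singleton]
    omega
  · intro d hd
    rw [coeff_seriesH, if_neg]
    intro h
    exact hij (Finset.mem_singleton.1 (h (Finsupp.mem_support_iff.2 hd))).symm

lemma pairing_eq_of_mk_eq {γ : UDual N} (hγ : γ ∈ perp (idealC N)) {z z' : U N}
    (h : (idealC N).ringCon.mk' z = (idealC N).ringCon.mk' z') : pairing z γ = pairing z' γ := by
  rw [← sub_eq_zero, ← pairingHom_apply, ← pairingHom_apply, ← map_sub, pairingHom_apply]
  apply hγ
  rw [← mk_eq_zero_iff, map_sub, h, sub_self]

lemma list_prod_range {M : Type*} [CommMonoid M] (f : ℕ → M) (n : ℕ) :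
    ((List.range n).map f).prod = ∏ j ∈ Finset.range n, f j := by
  induction n with
  | zero => simp
  | succ n ih => simp [List.range_succ, Finset.prod_range_succ, ih]

/-- Modulo `I_C`, the coefficients of the Cauchy product come from a commutative ring in which
the noncommutative Schur functions are Jacobi–Trudi determinants. -/
lemma exists_commRing_cauchyProduct (N : ℕ) : ∃ (C : Type) (_ : CommRing C)
    (φ : C →+* (idealC N).ringCon.Quotient) (h : ℕ → C), h 0 = 1 ∧
    (∀ n (d : ℕ →₀ ℕ), (∀ j, n ≤ j → d j = 0) →
      (idealC N).ringCon.mk' (MvPowerSeries.coeff d (cauchyProduct N))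
        = φ (∏ j ∈ Finset.range n, h (d j))) ∧
    ∀ d : ℕ →₀ ℕ, (idealC N).ringCon.mk' (MvPowerSeries.coeff d (cauchyProduct N))
      = (idealC N).ringCon.mk' (∑ μ ∈ diagrams d.degree, (kostka μ d : ℤ) • ncSchur N μ) := by
  obtain ⟨C, _, φ, h, e, hh, he, h0, e0, heh⟩ := exists_commRing_lift _ (mk_relations (N := N))
  have hcoeff : ∀ n (d : ℕ →₀ ℕ), (∀ j, n ≤ j → d j = 0) →
      (idealC N).ringCon.mk' (MvPowerSeries.coeff d (cauchyProduct N))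
        = φ (∏ j ∈ Finset.range n, h (d j)) := by
    intro n d hd
    rw [coeff_cauchyProduct n d hd, ← list_prod_range, map_list_prod, map_list_prod, List.map_map,
      List.map_map]
    congr 1
    exact List.map_congr_left fun j _ => (hh _).symm
  refine ⟨C, inferInstance, φ, h, h0, hcoeff, fun d => ?_⟩
  obtain ⟨n, hn⟩ := exists_forall_ge_eq_zero d
  set E : ℤ → C := fun k => if k < 0 then 0 else e k.toNat with hE
  have hEelem : ∀ k, φ (E k) = (idealC N).ringCon.mk' (elem N k) := by
    intro k
    simp only [hE, elem]
    split_ifs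
    · rw [map_zero, map_zero]
    · rw [he]
  have hdet : ∀ μ : YoungDiagram,
      φ (columnDet E (μ.rowLen 0) μ) = (idealC N).ringCon.mk' (ncSchur N μ) := by
    intro μ
    -- Transposing turns the term of π into ∏ e(λ'_i + π(i) - i) indexed by i, so the factors can be
    -- listed in the order used by `ncSchur`.
    rw [columnDet, toeplitzDet, ← Matrix.det_transpose, Matrix.det_apply, map_sum, ncSchur, map_sum]
    refine Finset.sum_congr rfl fun π _ => ?_
    rw [Units.smul_def, map_zsmul, map_zsmul, ← List.prod_ofFn, map_list_prod, map_list_prod,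
      List.map_ofFn, List.map_ofFn]
    congr 3
    ext i
    exact hEelem _
  rw [hcoeff n d hn, prod_eq_sum_kostka E h h0 (by simp [hE, e0]) (fun k hk => if_pos hk)
    (fun k hk => ?_) n d hn, map_sum, map_sum]
  · refine Finset.sum_congr rfl fun μ _ => ?_
    rw [map_mul, map_natCast, hdet, map_zsmul, natCast_zsmul, nsmul_eq_mul]
  · have hEnat : ∀ m : ℕ, E m = e m := fun m => by
      simp only [hE]
      rw [if_neg (by omega), Int.toNat_natCast]
    simpa only [hEnat] using heh k hk

lemma F_apply_eq_sum {γ : UDual N} (hγ : γ ∈ perp (idealC N)) (d : ℕ →₀ ℕ) :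
    F γ d = ∑ μ ∈ diagrams d.degree, pairing (ncSchur N μ) γ * kostka μ d := by
  obtain ⟨C, _, φ, h, -, -, hsum⟩ := exists_commRing_cauchyProduct N
  rw [F, pairing_eq_of_mk_eq hγ (hsum d), ← pairingHom_apply, map_sum]
  refine Finset.sum_congr rfl fun μ _ => ?_
  rw [map_zsmul, pairingHom_apply, smul_eq_mul, mul_comm]

/-- Modulo I_C the coefficient of x^d comes from a commutative product of the h_{d_j}, which depends
only on the multiset of nonzero exponents, as h_0 = 1. -/
theorem isSymmetricSeries_F {γ : UDual N} (hγ : γ ∈ perp (idealC N)) :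
    IsSymmetricSeries (F γ) := by
  intro σ
  obtain ⟨C, _, φ, h, h0, hprod, -⟩ := exists_commRing_cauchyProduct N
  have hprod' : ∀ d : ℕ →₀ ℕ, (idealC N).ringCon.mk' (MvPowerSeries.coeff d (cauchyProduct N))
      = φ (d.prod fun _ k => h k) := by
    intro d
    obtain ⟨n, hn⟩ := exists_forall_ge_eq_zero d
    rw [hprod n d hn, Finsupp.prod_of_support_subset d (s := Finset.range n)]
    · intro j hj
      rw [Finset.mem_range]
      by_contra hc
      exact Finsupp.mem_support_iff.1 hj (hn j (not_lt.1 hc))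
    · exact fun _ _ => h0
  ext x
  obtain ⟨y, rfl⟩ : ∃ y, x = Finsupp.embDomain σ.toEmbedding y :=
    ⟨Finsupp.equivMapDomain σ.symm x, by
      ext j
      obtain ⟨i, rfl⟩ := σ.surjective j
      refine Eq.trans ?_ (Finsupp.embDomain_apply_self σ.toEmbedding _ i).symm
      simp⟩
  refine (MvPowerSeries.coeff_embDomain_rename σ.toEmbedding (F γ) y).trans ?_
  change pairing _ γ = pairing _ γ
  apply pairing_eq_of_mk_eq hγ
  rw [hprod', hprod', Finsupp.prod_embDomain]

theorem F_eq_finsum_schur {γ : UDual N} (hγ : γ ∈ perp (idealC N)) :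
    F γ = ∑ᶠ μ : YoungDiagram, pairing (ncSchur N μ) γ • schur μ := by
  classical
  ext d
  -- This set contains both the support of the sum over all diagrams and the diagrams that can have
  -- content d; the extra terms vanish.
  set s : Finset YoungDiagram := (finite_pairing_ncSchur γ).toFinset ∪ diagrams d.degree with hs
  rw [finsum_eq_sum_of_support_subset (s := s), map_sum]
  · change F γ d = ∑ μ ∈ s, pairing (ncSchur N μ) γ * schur μ d
    rw [F_apply_eq_sum hγ, Finset.sum_subset (Finset.subset_union_right (s₁ :=
      (finite_pairing_ncSchur γ).toFinset))]
    · rfl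
    · intro μ _ hμ
      rw [mem_diagrams] at hμ
      rw [kostka_eq_zero hμ, Nat.cast_zero, mul_zero]
  · intro μ hμ
    rw [Function.mem_support] at hμ
    rw [hs, Finset.mem_coe, Finset.mem_union, Set.Finite.mem_toFinset]
    left
    intro hc
    exact hμ (by rw [hc, zero_smul])

end Quotient
end NCSchur

open NCSchur in
theorem proposition2p5 (N : ℕ) :
    -- the `h_l(u)` commute modulo every ideal containing `I_C`, and `H(x) H(y) ≡ H(y) H(x)`
    (∀ I : TwoSidedIdeal (U N), idealC N ≤ I →
      (∀ k l : ℕ, homog N k * homog N l - homog N l * homog N k ∈ I) ∧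
      (∀ d : Fin 2 →₀ ℕ, MvPowerSeries.coeff d
        (seriesH N (0 : Fin 2) * seriesH N 1 - seriesH N 1 * seriesH N 0) ∈ I)) ∧
    -- the expansion of `F_γ` into fundamental quasisymmetric functions, for every `γ`
    (∀ γ : UDual N, F γ = ∑ w ∈ γ.support,
      γ w • fundamentalQ w.toList.length (descents w.toList)) ∧
    -- symmetry and Schur expansion of `F_γ`
    (∀ γ ∈ perp (idealC N),
      IsSymmetricSeries (F γ) ∧
      {μ : YoungDiagram | pairing (ncSchur N μ) γ ≠ 0}.Finite ∧
      F γ = ∑ᶠ μ : YoungDiagram, pairing (ncSchur N μ) γ • schur μ) := by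
  refine ⟨fun I hI => ⟨fun k l => hI (homog_comm_mem k l), fun d => ?_⟩, F_eq_sum_fundamentalQ,
    fun γ hγ => ⟨isSymmetricSeries_F hγ, finite_pairing_ncSchur γ, F_eq_finsum_schur hγ⟩⟩
  rw [map_sub, coeff_seriesH_mul_seriesH (by decide), coeff_seriesH_mul_seriesH (by decide)]
  exact hI (homog_comm_mem _ _)
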